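/- **Theorem 4.3.** Let $p$ be a prime, $s\ge 1$, $K=GF(p^s)$, and let $F$ be the local field of formal Laurent series $x=\sum_k x_kt^k$ over $K$, with its usual topology, $F_n=\{x: x_k=0 \text{ for } k<n\}$ and the Haar measure $\mu$ with $\mu(F_0)=1$. Let $\mathcal A$ be the dilation $\sum_k x_kt^k\mapsto\sum_k x_kt^{k-1}$, let $H_0=\{h\in F: h_k=0\text{ for }k\ge 0\}$ be the set of shifts, and let $H_0^{(N+1)}$ be the set of $h\in H_0$ with $h_k=0$ for $k<-N-1$. Let $X$ be the group of continuous characters of the additive group of $F$, $(\chi\mathcal A^{k})(x)=\chi(\mathcal A^{k}x)$, and $F_n^\perp\le X$ the annihilator of $F_n$. Fix a basis of $K$ over $\mathbb Z/p$, write $u^{(l)}$ for the coordinates of $u\in K$, and for $k\in\mathbb Z$, $u\in K$ let $\mathbf r_k^{u}(x)=\prod_l e^{\frac{2\pi i}{p}u^{(l)}x_k^{(l)}}$. Let $\mathfrak D_M(F_{-N})$ be the set of functions $F\to\mathbb C$ constant on the cosets of $F_M$ and supported in $F_{-N}$, and $\mathfrak D_{-N}(F_M^\perp)$ the set of functions $X\to\mathbb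 C$ constant on the cosets of $F_{-N}^\perp$ and supported in $F_M^\perp$. Let $N\ge 1$. Let $T$ be an $N$-valid tree: a rooted tree, with arcs directed towards the root, whose vertices are labelled by elements of $K$, such that the root and all vertices of level at most $N-1$ have label $0$, and every sequence of $N$ elements of $K$ is the label sequence of exactly one directed path with $N$ vertices. Let $\tilde T$ be the tree with vertex set $K^N$ in which $\mathbf A=(a_N,\dots,a_1)$ stands for the path of $T$ with these labels, the root is $(0,\dots,0)$, and the parent of $\mathbf A\ne 0$ is the label array of the path of $N$ vertices that starts at the parent of the first vertex of the path of $\mathbf A$. Let $\tilde H$ be the height of $\tilde T$ (the largest level of a vertex). Let $\Gamma$ be the digraph on $K^N$ in which $(a_N,\dots,a_1)$ is connected to all vertices of the form $(a_{N-1},\dots,a_1,a_0)$ whose level in $\tilde T$ is smaller. Let $m_0:X\to\mathbb C$ be a mask, that is, $m_0(\chi)=\frac1{p^s}\sum_{h\in H_0^{(N+1)}}\beta_h\overline{(\chi\mathcal A^{-1})(h)}$ with complex coefficients $\beta_h$, and put $$\lambda_{a_N,\dots,a_1,a_0}=\bigl|m_0\bigl(\mathbf r_{-N}^{a_N}\mathbf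 r_{-N+1}^{a_{N-1}}\cdots\mathbf r_{-1}^{a_1}\mathbf r_0^{a_0}\bigr)\bigr|^2 .$$ Assume that $m_0=1$ on $F_{-N}^\perp$; that for every $\mathbf A=(a_N,\dots,a_1)$ with at least one outgoing arc in $\Gamma$ the sum of $\lambda_{a_N,\dots,a_1,a_0}$ over those $a_0$ for which $\mathbf A$ is connected to $(a_{N-1},\dots,a_1,a_0)$ is $1$; and that $\lambda_{a_N,\dots,a_1,a_0}=0$ for all $(a_N,\dots,a_0)\ne(0,\dots,0)$ such that $\mathbf A$ is not connected to $(a_{N-1},\dots,a_1,a_0)$ in $\Gamma$. Then the product $\hat\varphi(\chi)=\prod_{k=0}^\infty m_0(\chi\mathcal A^{-k})$ converges for every $\chi\in X$, and there is an integer $M$ with $0\le M\le\tilde H-N$ such that $\hat\varphi\in\mathfrak D_{-N}(F_M^\perp)$ and $\hat\varphi$ is the Fourier transform $\hat\varphi(\chi)=\int_F\varphi(x)\overline{\chi(x)}\,d\mu(x)$ of a function $\varphi\in\mathfrak D_M(F_{-N})$ which is an orthogonal scaling function, i.e. generates an orthogonal multiresolution analysis: there are closed subspaces $V_n$ ($n\in\mathbb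 Z$) of $L^2(F)$ with $V_n\subset V_{n+1}$, $\overline{\bigcup_n V_n}=L^2(F)$, $\bigcap_n V_n=\{0\}$, $f\in V_n\iff f(\mathcal A\,\cdot)\in V_{n+1}$, and such that $(\varphi(\cdot-h))_{h\in H_0}$ is an orthonormal basis of $V_0$. -/

import Mathlib

open MeasureTheory Topology
open scoped ComplexConjugate

noncomputable section

namespace LocalFieldMRA

/-! ### The local field of formal Laurent series over a finite field `K`

`LaurentSeries K` carries Mathlib's `X`-adic topology. -/

section Field

variable (K : Type*) [Field K]

/-- The subgroup of all series `∑_{j ≥ n} a_j t^j`. -/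
def Ball (n : ℤ) : AddSubgroup (LaurentSeries K) where
  carrier := {x | ∀ j : ℤ, j < n → x.coeff j = 0}
  zero_mem' := by intro j _; simp
  add_mem' := by
    intro x y hx hy j hj
    simp [hx j hj, hy j hj]
  neg_mem' := by
    intro x hx j hj
    simp [hx j hj]

variable {K}

theorem mem_Ball {n : ℤ} {x : LaurentSeries K} :
    x ∈ Ball K n ↔ ∀ j : ℤ, j < n → x.coeff j = 0 := Iff.rfl

theorem mem_Ball_iff_valuation {n : ℤ} {x : LaurentSeries K} :
    x ∈ Ball K n ↔ Valued.v x ≤ WithZero.exp (-n : ℤ) :=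
  (LaurentSeries.valuation_le_iff_coeff_lt_eq_zero K).symm

theorem Ball_mem_nhds (n : ℤ) : (Ball K n : Set (LaurentSeries K)) ∈ 𝓝 0 := by
  have hv : Valued.v (HahnSeries.single n (1 : K) : LaurentSeries K) = WithZero.exp (-n : ℤ) :=
    LaurentSeries.valuation_single_zpow K n
  have hne : Valued.v.restrict (HahnSeries.single n (1 : K) : LaurentSeries K) ≠ 0 := by
    simp
  rw [Valued.mem_nhds_zero]
  refine ⟨Units.mk0 _ hne, fun x hx => ?_⟩
  have hx' : Valued.v x < Valued.v (HahnSeries.single n (1 : K) : LaurentSeries K) := by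
    simpa using hx
  rw [SetLike.mem_coe, mem_Ball_iff_valuation, ← hv]
  exact hx'.le

theorem exists_Ball_subset {U : Set (LaurentSeries K)} (hU : U ∈ 𝓝 0) :
    ∃ n : ℤ, (Ball K n : Set (LaurentSeries K)) ⊆ U := by
  obtain ⟨γ, hγ⟩ := Valued.mem_nhds_zero.1 hU
  set d : WithZero (Multiplicative ℤ) := MonoidWithZeroHom.ValueGroup₀.embedding γ.1 with hd
  have hd0 : d ≠ 0 := by simp [hd]
  refine ⟨-(WithZero.log d) + 1, fun x hx => hγ ?_⟩
  rw [SetLike.mem_coe, mem_Ball_iff_valuation] at hx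
  show Valued.v.restrict x < γ.1
  rw [Valuation.restrict_lt_iff_lt_embedding]
  refine lt_of_le_of_lt hx ?_
  rw [← hd, ← WithZero.lt_log_iff_exp_lt hd0]
  lia

theorem isCompact_Ball_zero [Finite K] : IsCompact (Ball K 0 : Set (LaurentSeries K)) := by
  let _ : TopologicalSpace K := ⊥
  have _ : DiscreteTopology K := ⟨rfl⟩
  let g : (ℕ → K) → LaurentSeries K := fun f => HahnSeries.ofPowerSeries ℤ K (PowerSeries.mk f)
  have hg : Continuous g := by
    rw [continuous_iff_continuousAt]
    intro f U hU
    have hU' : (fun y => g f + y) ⁻¹' U ∈ 𝓝 (0 : LaurentSeries K) := by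
      refine (continuous_const.add continuous_id).continuousAt ?_
      simpa using hU
    obtain ⟨n, hn⟩ := exists_Ball_subset hU'
    have hopen : {f' : ℕ → K | ∀ i ∈ Finset.range n.toNat, f' i = f i} ∈ 𝓝 f := by
      have : {f' : ℕ → K | ∀ i ∈ Finset.range n.toNat, f' i = f i}
          = (Finset.range n.toNat : Set ℕ).pi fun i => {f i} := by
        ext; simp [Set.mem_pi]
      rw [this]
      exact set_pi_mem_nhds (Finset.finite_toSet _) fun i _ => by simp
    refine Filter.mem_map.2 (Filter.mem_of_superset hopen fun f' hf' => ?_)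
    have h1 : g f' - g f ∈ Ball K n := by
      intro j hj
      have h2 : g f' - g f = HahnSeries.ofPowerSeries ℤ K (PowerSeries.mk f' - PowerSeries.mk f) := by
        simp [g]
      rw [h2, PowerSeries.coeff_coe]
      split_ifs with h0
      · rfl
      · have := hf' j.natAbs (by rw [Finset.mem_range]; lia)
        simp [this]
    simpa using hn h1
  have himg : (Ball K 0 : Set (LaurentSeries K)) = Set.range g := by
    ext x
    constructor
    · intro hx
      refine ⟨fun n => x.coeff n, ?_⟩
      ext j
      show (HahnSeries.ofPowerSeries ℤ K _).coeff j = _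
      rw [PowerSeries.coeff_coe]
      split_ifs with h0
      · exact (hx j h0).symm
      · rw [PowerSeries.coeff_mk]
        congr 1
        lia
    · rintro ⟨f, rfl⟩ j hj
      show (HahnSeries.ofPowerSeries ℤ K _).coeff j = _
      rw [PowerSeries.coeff_coe, if_pos hj]
  rw [himg]
  exact isCompact_range hg

theorem interior_Ball_nonempty (n : ℤ) :
    (interior (Ball K n : Set (LaurentSeries K))).Nonempty :=
  ⟨0, mem_interior_iff_mem_nhds.2 (Ball_mem_nhds n)⟩

instance : MeasurableSpace (LaurentSeries K) := borel _

instance : BorelSpace (LaurentSeries K) := ⟨rfl⟩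

variable (K) in
/-- The Haar measure of the additive group, normalized so that `∑_{j ≥ 0} a_j t^j` has measure
one. -/
def haar [Finite K] : Measure (LaurentSeries K) :=
  Measure.addHaarMeasure ⟨⟨(Ball K 0 : Set (LaurentSeries K)), isCompact_Ball_zero⟩,
    interior_Ball_nonempty 0⟩

/-- The power `A ^ k` of the dilation `A : ∑ a_n t^n ↦ ∑ a_n t^(n-1)`. -/
def dil (k : ℤ) (x : LaurentSeries K) : LaurentSeries K :=
  HahnSeries.single (-k) (1 : K) * x

theorem coeff_dil (k n : ℤ) (x : LaurentSeries K) : (dil k x).coeff n = x.coeff (n + k) := by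
  have h := HahnSeries.coeff_single_mul_add (r := (1 : K)) (x := x) (a := n + k) (b := -k)
  rw [one_mul, show n + k + -k = n by ring] at h
  exact h

theorem dil_add (k : ℤ) (x y : LaurentSeries K) : dil k (x + y) = dil k x + dil k y :=
  mul_add _ _ _

theorem continuous_dil (k : ℤ) : Continuous (dil (K := K) k) :=
  continuous_const.mul continuous_id

variable (K) in
/-- The set of shifts: all finite sums `a_{-1} t^{-1} + ... + a_{-n} t^{-n}`. -/
def shifts : Set (LaurentSeries K) := {h | ∀ j : ℤ, 0 ≤ j → h.coeff j = 0}

/-- The shift `c_0 t^{-1} + ... + c_{n-1} t^{-n}`. -/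
def shiftElt {n : ℕ} (c : Fin n → K) : LaurentSeries K :=
  ∑ i : Fin n, HahnSeries.single (-((i : ℤ) + 1)) (c i)

/-! ### Characters -/

variable (K) in
/-- The group of all (continuous) characters of the additive group of the field. -/
def Characters : Subgroup (AddChar (LaurentSeries K) Circle) where
  carrier := {χ | Continuous χ}
  one_mem' := continuous_const
  mul_mem' := by
    intro χ ψ hχ hψ
    exact (show Continuous fun x => χ x * ψ x from Continuous.mul hχ hψ)
  inv_mem' := by
    intro χ hχ
    exact (show Continuous fun x => χ (-x) from Continuous.comp hχ continuous_neg)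

/-- The value of a character, as a complex number. -/
def ev (χ : Characters K) (x : LaurentSeries K) : ℂ := ((χ : AddChar (LaurentSeries K) Circle) x : ℂ)

/-- The annihilator of a subgroup. -/
def annihilator (H : AddSubgroup (LaurentSeries K)) : Subgroup (Characters K) where
  carrier := {χ | ∀ x ∈ H, (χ : AddChar (LaurentSeries K) Circle) x = 1}
  one_mem' := fun _ _ => rfl
  mul_mem' := by
    intro χ ψ hχ hψ x hx
    simp [hχ x hx, hψ x hx]
  inv_mem' := by
    intro χ hχ x hx
    simpa using hχ (-x) (H.neg_mem hx)

/-- The character `χ A^k`, that is, `x ↦ χ (A^k x)`. -/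
def dilChar (χ : Characters K) (k : ℤ) : Characters K :=
  ⟨{ toFun := fun x => (χ : AddChar (LaurentSeries K) Circle) (dil k x)
     map_zero_eq_one' := by simp [dil]
     map_add_eq_mul' := by intro x y; rw [dil_add, AddChar.map_add_eq_mul] },
    χ.2.comp (continuous_dil k)⟩

theorem continuous_of_trivial_on_Ball (χ : AddChar (LaurentSeries K) Circle) (n : ℤ)
    (h : ∀ x ∈ Ball K n, χ x = 1) : Continuous χ := by
  have h0 : ContinuousAt (χ.toMonoidHom : Multiplicative (LaurentSeries K) → Circle) 1 := by
    intro U hU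
    exact Filter.mem_map.2 (Filter.mem_of_superset (Ball_mem_nhds n) fun x hx => by
      have h1 : χ x = 1 := h x hx
      have h2 := mem_of_mem_nhds hU
      rw [map_one] at h2
      show χ x ∈ U
      rwa [h1])
  exact continuous_of_continuousAt_one χ.toMonoidHom h0

/-- The character `r_k^u : x ↦ ∏_l exp (2πi u^(l) x_k^(l) / p)`, where `x_k` is the `k`-th
coefficient of `x` and `u^(l)`, `x_k^(l)` are the coordinates in a fixed basis `b` of `K` over
`ℤ/p`. -/
def rad {p s : ℕ} [Fact p.Prime] [Algebra (ZMod p) K] (b : Module.Basis (Fin s) (ZMod p) K)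
    (k : ℤ) (u : K) : Characters K :=
  ⟨{ toFun := fun x => ∏ l : Fin s, ZMod.toCircle (b.repr u l * b.repr (x.coeff k) l)
     map_zero_eq_one' := by simp
     map_add_eq_mul' := by
      intro x y
      rw [← Finset.prod_mul_distrib]
      refine Finset.prod_congr rfl fun l _ => ?_
      rw [← AddChar.map_add_eq_mul, ← mul_add]
      simp },
    by
      refine continuous_of_trivial_on_Ball _ (k + 1) fun x hx => ?_
      have h0 : x.coeff k = 0 := hx k (by lia)
      simp [h0]⟩

/-! ### Step functions and the Fourier transform -/

/-- Functions on the field constant on the cosets of `Ball K M` and supported in `Ball K n`. -/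
def stepFun (M n : ℤ) : Set (LaurentSeries K → ℂ) :=
  {f | (∀ x, ∀ y ∈ Ball K M, f (x + y) = f x) ∧ ∀ x, f x ≠ 0 → x ∈ Ball K n}

/-- Functions on the character group constant on the cosets of the annihilator of `Ball K n` and
supported in the annihilator of `Ball K M`. -/
def dualStepFun (n M : ℤ) : Set (Characters K → ℂ) :=
  {g | (∀ χ, ∀ ψ ∈ annihilator (Ball K n), g (χ * ψ) = g χ) ∧
    ∀ χ, g χ ≠ 0 → χ ∈ annihilator (Ball K M)}

/-- The Fourier transform. -/
def fourier [Finite K] (f : LaurentSeries K → ℂ) (χ : Characters K) : ℂ :=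
  ∫ x, f x * conj (ev χ x) ∂(haar K)

/-! ### Orthogonal multiresolution analyses -/

/-- The subspaces `V n` of `L²` form an orthogonal multiresolution analysis generated by `φ`. -/
structure IsOrthogonalMRA [Finite K] (V : ℤ → Submodule ℂ (Lp ℂ 2 (haar K)))
    (φ : LaurentSeries K → ℂ) : Prop where
  isClosed : ∀ n, IsClosed (V n : Set (Lp ℂ 2 (haar K)))
  mono : ∀ n, V n ≤ V (n + 1)
  dense : Dense (⋃ n, (V n : Set (Lp ℂ 2 (haar K))))
  inter : ⨅ n, V n = ⊥
  dilation : ∀ n, ∀ f g : Lp ℂ 2 (haar K), (∀ᵐ x ∂(haar K), g x = f (dil 1 x)) →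
    (f ∈ V n ↔ g ∈ V (n + 1))
  /-- The shifts of `φ` form an orthonormal basis of `V 0`. -/
  basis : ∃ e : shifts K → Lp ℂ 2 (haar K),
    (∀ h : shifts K, ∀ᵐ x ∂(haar K), e h x = φ (x - (h : LaurentSeries K))) ∧
    Orthonormal ℂ e ∧ (Submodule.span ℂ (Set.range e)).topologicalClosure = V 0

/-- `φ` generates an orthogonal multiresolution analysis. -/
def IsOrthogonalScalingFunction [Finite K] (φ : LaurentSeries K → ℂ) : Prop :=
  ∃ V : ℤ → Submodule ℂ (Lp ℂ 2 (haar K)), IsOrthogonalMRA V φ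

/-! ### Masks -/

/-- `m₀` is the mask of a refinement equation `φ(x) = ∑ β_h φ(A x - h)`, where `h` runs over
`a_{-1} t^{-1} + ... + a_{-N-1} t^{-N-1}`. -/
def IsMask [Fintype K] (N : ℕ) (m₀ : Characters K → ℂ) : Prop :=
  ∃ β : (Fin (N + 1) → K) → ℂ, ∀ χ, m₀ χ =
    1 / (Fintype.card K : ℂ) * ∑ c, β c * conj (ev (dilChar χ (-1)) (shiftElt c))

/-- The infinite product `∏_{k ≥ 0} m₀(χ A^{-k})`. -/
def maskProduct (m₀ : Characters K → ℂ) (χ : Characters K) : ℂ :=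
  ∏' k : ℕ, m₀ (dilChar χ (-(k : ℤ)))

/-- The number `|m₀(r_{-N}^{c_0} r_{-N+1}^{c_1} ⋯ r_0^{c_N})|²`. -/
def lam {p s : ℕ} [Fact p.Prime] [Algebra (ZMod p) K] (b : Module.Basis (Fin s) (ZMod p) K)
    {N : ℕ} (m₀ : Characters K → ℂ) (c : Fin (N + 1) → K) : ℝ :=
  ‖m₀ (∏ i : Fin (N + 1), rad b ((i : ℤ) - N) (c i))‖ ^ 2

end Field

/-! ### Trees -/

/-- A rooted tree, given by the map sending a vertex to its parent (the root to itself). -/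
structure RTree (V : Type*) where
  root : V
  parent : V → V
  parent_root : parent root = root
  reaches : ∀ v, ∃ n : ℕ, parent^[n] v = root

namespace RTree

variable {V K : Type*}

/-- The distance of a vertex to the root. -/
def level (T : RTree V) (v : V) : ℕ := sInf {n : ℕ | T.parent^[n] v = T.root}

/-- The largest level of a vertex. -/
def height [Fintype V] (T : RTree V) : ℕ := Finset.univ.sup T.level

/-- The labels of the first `N` vertices on the path from `v` towards the root. -/
def pathArray (T : RTree V) (lab : V → K) (N : ℕ) (v : V) : Fin N → K :=
  fun i => lab (T.parent^[(i : ℕ)] v)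

/-- `T` is `N`-valid: the root and all vertices up to level `N - 1` are labelled by zero, and every
sequence of `N` labels is read exactly once along a path of `N` vertices directed to the root. A
vertex `v` starts such a path if and only if its level is at least `N - 1`. -/
structure NValid [Zero K] (T : RTree V) (lab : V → K) (N : ℕ) : Prop where
  zero : ∀ v, T.level v + 1 ≤ N → lab v = 0
  path : ∀ A : Fin N → K, ∃! v, N ≤ T.level v + 1 ∧ T.pathArray lab N v = A

variable [Zero K] {T : RTree V} {lab : V → K} {N : ℕ}

/-- The starting vertex of the unique path with labels `A`. -/
def NValid.start (h : T.NValid lab N) (A : Fin N → K) : V := (h.path A).choose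

open Classical in
/-- The parent of an array in the derived tree: the array read from the next vertex of `T`. -/
def NValid.arrayParent (h : T.NValid lab N) (A : Fin N → K) : Fin N → K :=
  if A = 0 then 0 else T.pathArray lab N (T.parent (h.start A))

theorem level_spec (T : RTree V) (v : V) : T.parent^[T.level v] v = T.root :=
  Nat.sInf_mem (T.reaches v)

theorem NValid.reaches_zero (h : T.NValid lab N) (A : Fin N → K) :
    ∃ n : ℕ, h.arrayParent^[n] A = 0 := by
  suffices H : ∀ (l : ℕ) (A : Fin N → K), T.level (h.start A) ≤ l →
      ∃ n : ℕ, h.arrayParent^[n] A = 0 from H _ A le_rfl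
  have hstart : ∀ A, N ≤ T.level (h.start A) + 1 ∧ T.pathArray lab N (h.start A) = A :=
    fun A => (h.path A).choose_spec.1
  have hle : ∀ v n, T.level (T.parent^[n] v) ≤ T.level v - n := by
    intro v n
    rcases le_total n (T.level v) with hn | hn
    · refine Nat.sInf_le ?_
      show T.parent^[T.level v - n] (T.parent^[n] v) = T.root
      rw [← Function.iterate_add_apply, Nat.sub_add_cancel hn, T.level_spec]
    · have hroot : ∀ m, T.parent^[m] T.root = T.root := fun m =>
        Function.iterate_fixed T.parent_root m
      have : T.parent^[n] v = T.root := by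
        obtain ⟨m, rfl⟩ := Nat.exists_eq_add_of_le hn
        rw [add_comm, Function.iterate_add_apply, T.level_spec, hroot]
      rw [this]
      exact (Nat.sInf_le (show T.parent^[0] T.root = T.root from rfl)).trans (Nat.zero_le _)
  have hge : ∀ v, T.level v ≤ T.level (T.parent v) + 1 := by
    intro v
    refine Nat.sInf_le ?_
    show T.parent^[T.level (T.parent v) + 1] v = T.root
    rw [Function.iterate_succ_apply, T.level_spec]
  have hbig : ∀ A : Fin N → K, A ≠ 0 → N ≤ T.level (h.start A) := by
    intro A hA
    by_contra hlt
    refine hA ?_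
    rw [← (hstart A).2]
    funext i
    refine h.zero _ ?_
    have := hle (h.start A) i
    lia
  intro l
  induction l with
  | zero =>
    intro A hl
    refine ⟨0, ?_⟩
    by_contra hA
    have h1 := hbig A hA
    refine hA (funext fun i => ?_)
    have := i.2
    lia
  | succ l ih =>
    intro A hl
    by_cases hA : A = 0
    · exact ⟨0, hA⟩
    · have h1 := hbig A hA
      have hpar : h.start (h.arrayParent A) = T.parent (h.start A) := by
        refine (h.path (h.arrayParent A)).unique (hstart _) ⟨?_, ?_⟩
        · exact h1.trans (hge _)
        · rw [NValid.arrayParent, if_neg hA]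
      have hN : 0 < N := by
        rcases Nat.eq_zero_or_pos N with h0 | h0
        · subst h0
          exact absurd (Subsingleton.elim A 0) hA
        · exact h0
      obtain ⟨n, hn⟩ := ih (h.arrayParent A) (by
        rw [hpar]
        have := hle (h.start A) 1
        simp only [Function.iterate_one] at this
        lia)
      exact ⟨n + 1, by rwa [Function.iterate_succ_apply]⟩

/-- The derived tree: its vertices are the arrays of `N` labels (each being read along exactly one
path of `T`), its arcs are those of `T`, its root is the zero array. -/
def NValid.derivedTree (h : T.NValid lab N) : RTree (Fin N → K) where
  root := 0
  parent := h.arrayParent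
  parent_root := by simp [NValid.arrayParent]
  reaches := h.reaches_zero

end RTree

/-- The digraph of a tree of arrays: `A = (a_N, ..., a_1)` is connected to every vertex of smaller
level of the form `(a_{N-1}, ..., a_1, a_0)`. -/
def arrayDigraph {K : Type*} {N : ℕ} (S : RTree (Fin N → K)) : Digraph (Fin N → K) where
  Adj A B := S.level B < S.level A ∧ ∀ i j : Fin N, (j : ℕ) = i + 1 → B i = A j

open Classical in
/-- The values `λ = |m₀|²` are adapted to the digraph `Γ`: if a vertex `A = (a_N, ..., a_1)` has
outgoing arcs, then the sum of `λ(a_N, ..., a_1, a)` over all `a` such that `A` is connected to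
`(a_{N-1}, ..., a_1, a)` is one; `λ(a_N, ..., a_1, a)` vanishes for all other `a` (except that
`λ(0, ..., 0) = 1`), and `m₀` is one on the annihilator of `Ball K (-N)`. Here
`Fin.tail (Fin.snoc A a)` is `(a_{N-1}, ..., a_1, a)`. -/
structure IsAdapted {p s : ℕ} [Fact p.Prime] {K : Type*} [Field K] [Fintype K] [Algebra (ZMod p) K]
    (b : Module.Basis (Fin s) (ZMod p) K) {N : ℕ} (Γ : Digraph (Fin N → K))
    (m₀ : Characters K → ℂ) : Prop where
  sum_eq_one : ∀ A : Fin N → K, (∃ B, Γ.Adj A B) →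
    ∑ a ∈ Finset.univ.filter
      (fun a : K => Γ.Adj A (Fin.tail (Fin.snoc A a : Fin (N + 1) → K))),
      lam b m₀ (Fin.snoc A a : Fin (N + 1) → K) = 1
  eq_zero : ∀ (A : Fin N → K) (a : K), (A ≠ 0 ∨ a ≠ 0) →
    ¬ Γ.Adj A (Fin.tail (Fin.snoc A a : Fin (N + 1) → K)) →
    lam b m₀ (Fin.snoc A a : Fin (N + 1) → K) = 0
  eq_one : ∀ χ ∈ annihilator (Ball K (-(N : ℤ))), m₀ χ = 1

end LocalFieldMRA

end

/-! A character `χ` of `F` is encoded by its digits `u_k ∈ K`, the exponents in the formal product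
of the `r_k^{u_k}`. They vanish for large `k`, since `F` has exponent `p` and so `χ` is trivial on
some ball. Thus `χ ∈ F_n^⊥` means `u_k = 0` for `k ≥ n`, and `χ ↦ χA^{-k}` only shifts digits. A
mask sees the digits `-N, ..., 0`, so the squared modulus of the `k`-th factor of the product is `λ`
at the window of digits `k-N, ..., k-1` followed by the digit `k`. As `k` grows the window slides,
exactly as along an arc of `Γ`.

Support: if no factor vanishes, every slide is an arc of `Γ`, which lowers the level in the derived
tree, or the window is zero and remains so. After `H̃` slides the window is zero
(`IsAdapted.level_window`), so all digits from `H̃ - N` on vanish. Hence `M = H̃ - N` works, and `φ`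
is a finite inverse Fourier sum.

Orthonormality: the values `λ(A, a)` sum to one over `a` for every array `A`: a nonzero array has an
arc to its parent, and for the zero array only `λ(0, ..., 0) = 1` remains. Summing `|φ̂|²` over the
digits of nonnegative index, highest digit first, therefore gives one for each initial window
(`IsAdapted.sum_prod_norm_sq`). Plancherel and the orthogonality relations on `K^N` finish
(`IsAdapted.integral_conj_scalingFun`).

Multiresolution analysis: `φ̂(χ) = m₀(χ) φ̂(χA^{-1})` is the refinement equation and gives `V_n ⊂
V_{n+1}`. The zero array has no outgoing arc, so finitely many shifts of `φ` add up to the indicator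
of `F_{-N}` (`IsAdapted.sum_scalingFun_add`); thus the `V_n` contain the indicators of all small
balls, and the union is dense. A function in every `V_n` is invariant under all translations, hence
zero. -/

noncomputable section

namespace LocalFieldMRA

/-! ### Levels in rooted trees -/

namespace RTree

variable {V : Type*}

theorem level_root (T : RTree V) : T.level T.root = 0 :=
  Nat.le_zero.1 (Nat.sInf_le (show T.parent^[0] T.root = T.root from rfl))

theorem level_eq_zero {T : RTree V} {v : V} : T.level v = 0 ↔ v = T.root := by
  constructor
  · intro h
    have := T.level_spec v
    rwa [h] at this
  · rintro rfl
    exact T.level_root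

theorem level_parent {T : RTree V} {v : V} (hv : v ≠ T.root) :
    T.level v = T.level (T.parent v) + 1 := by
  have h0 : T.level v ≠ 0 := fun h => hv (level_eq_zero.1 h)
  apply le_antisymm
  · refine Nat.sInf_le ?_
    show T.parent^[T.level (T.parent v) + 1] v = T.root
    rw [Function.iterate_succ_apply, T.level_spec]
  · obtain ⟨m, hm⟩ := Nat.exists_eq_succ_of_ne_zero h0
    have h1 : T.level (T.parent v) ≤ m := by
      refine Nat.sInf_le ?_
      show T.parent^[m] (T.parent v) = T.root
      rw [← Function.iterate_succ_apply, ← hm, T.level_spec]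
    lia

theorem level_le_height [Fintype V] (T : RTree V) (v : V) : T.level v ≤ T.height :=
  Finset.le_sup (f := T.level) (Finset.mem_univ v)

variable {K : Type*} [Zero K] {T : RTree V} {lab : V → K} {N : ℕ}

theorem NValid.derivedTree_parent_apply (h : T.NValid lab N) {A : Fin N → K} (hA : A ≠ 0)
    (i j : Fin N) (hij : (j : ℕ) = i + 1) : h.derivedTree.parent A i = A j := by
  have h1 : h.derivedTree.parent A = T.pathArray lab N (T.parent (h.start A)) := if_neg hA
  have h2 : T.pathArray lab N (h.start A) = A := (h.path A).choose_spec.1.2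
  rw [h1]
  conv_rhs => rw [← h2]
  simp only [pathArray, hij, Function.iterate_succ_apply]

/-- Passing to the parent moves the entry at `j + 1` to position `j`. A nonzero entry thus survives
`j` steps towards the root, and the array reached is still nonzero. -/
theorem NValid.lt_level (h : T.NValid lab N) (j : ℕ) (hj : j < N) (A : Fin N → K)
    (hA : A ⟨j, hj⟩ ≠ 0) : j < h.derivedTree.level A := by
  induction j generalizing A with
  | zero =>
    refine Nat.pos_of_ne_zero fun h0 => hA ?_
    rw [level_eq_zero.1 h0]
    rfl
  | succ j ih =>
    have hA0 : A ≠ 0 := by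
      rintro rfl
      exact hA rfl
    rw [level_parent (T := h.derivedTree) hA0]
    have := ih (by lia) (h.derivedTree.parent A) (by
      rwa [h.derivedTree_parent_apply hA0 ⟨j, by lia⟩ ⟨j + 1, hj⟩ rfl])
    lia

/-- A constant nonzero array has a nonzero last entry. The bound makes `H̃ - N` a legitimate
nonnegative choice of `M`. -/
theorem NValid.le_height [Fintype K] [Nontrivial K] (h : T.NValid lab N) :
    N ≤ h.derivedTree.height := by
  obtain ⟨x, hx⟩ := exists_ne (0 : K)
  rcases Nat.eq_zero_or_pos N with h0 | h0
  · lia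
  · have h1 := h.lt_level (N - 1) (by lia) (fun _ => x) hx
    have h2 := h.derivedTree.level_le_height (fun _ => x)
    lia

/-- Every nonzero array is connected to its parent. -/
theorem NValid.arrayDigraph_adj_parent (h : T.NValid lab N) {A : Fin N → K} (hA : A ≠ 0) :
    (arrayDigraph h.derivedTree).Adj A (h.derivedTree.parent A) := by
  refine ⟨?_, fun i j hij => h.derivedTree_parent_apply hA i j hij⟩
  rw [level_parent (T := h.derivedTree) hA]
  lia

/-- The zero array is the root, and no level is below zero. A window that has become zero can
therefore continue only through `λ(0, ..., 0)`. -/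
theorem NValid.not_arrayDigraph_adj_zero (h : T.NValid lab N) (B : Fin N → K) :
    ¬ (arrayDigraph h.derivedTree).Adj 0 B := by
  rintro ⟨h1, -⟩
  have : h.derivedTree.level 0 = 0 := h.derivedTree.level_root
  lia

end RTree

/-- For an adapted mask, the values `λ(a_N, ..., a_1, a)` sum to one over all `a`. -/
theorem IsAdapted.sum_lam {p s : ℕ} [Fact p.Prime] {K : Type*} [Field K] [Fintype K]
    [Algebra (ZMod p) K] {b : Module.Basis (Fin s) (ZMod p) K} {N : ℕ} {V : Type*} {T : RTree V}
    {lab : V → K} {hT : T.NValid lab N} {m₀ : Characters K → ℂ}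
    (hm₀ : IsAdapted b (arrayDigraph hT.derivedTree) m₀) (A : Fin N → K) :
    ∑ a, lam b m₀ (Fin.snoc A a : Fin (N + 1) → K) = 1 := by
  classical
  by_cases hA : A = 0
  · subst hA
    rw [Finset.sum_eq_single 0]
    · have h1 : (Fin.snoc (0 : Fin N → K) 0 : Fin (N + 1) → K) = 0 := by
        funext i
        refine Fin.lastCases ?_ (fun i => ?_) i <;> simp
      have h2 : ∀ k : ℤ, rad b k 0 = 1 := by
        intro k
        refine Subtype.ext (DFunLike.ext _ _ fun x => ?_)
        simp [rad]
      rw [h1, lam]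
      simp [h2, hm₀.eq_one 1 (one_mem _)]
    · intro a _ ha
      exact hm₀.eq_zero 0 a (Or.inr ha) (hT.not_arrayDigraph_adj_zero _)
    · simp
  -- The arc to the parent supplies the outgoing arc that the hypothesis requires; the terms outside
  -- `Γ` are zero.
  · rw [← hm₀.sum_eq_one A ⟨_, hT.arrayDigraph_adj_parent hA⟩, eq_comm]
    refine Finset.sum_subset_zero_on_sdiff (Finset.subset_univ _) (fun a ha => ?_) fun _ _ => ?_
    · refine hm₀.eq_zero A a (Or.inl hA) ?_
      simpa using ha
    · congr!

section Pairing

variable {p s : ℕ} [Fact p.Prime] {K : Type*} [Field K] [Algebra (ZMod p) K]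
  (b : Module.Basis (Fin s) (ZMod p) K)

/-! ### The self-duality of the finite field -/

/-- The character `a ↦ ∏_l exp (2πi u^(l) a^(l) / p)` of the finite field. -/
def pairing (u : K) : AddChar K Circle where
  toFun a := ∏ l : Fin s, ZMod.toCircle (b.repr u l * b.repr a l)
  map_zero_eq_one' := by simp
  map_add_eq_mul' x y := by
    rw [← Finset.prod_mul_distrib]
    refine Finset.prod_congr rfl fun l _ => ?_
    rw [← AddChar.map_add_eq_mul, ← mul_add]
    simp

theorem pairing_apply (u a : K) :
    pairing b u a = ∏ l : Fin s, ZMod.toCircle (b.repr u l * b.repr a l) := rfl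

theorem pairing_comm (u a : K) : pairing b u a = pairing b a u := by
  simp [pairing_apply, mul_comm]

theorem pairing_zero_left (a : K) : pairing b 0 a = 1 := by simp [pairing_apply]

theorem pairing_add_left (u v a : K) : pairing b (u + v) a = pairing b u a * pairing b v a := by
  rw [pairing_comm, AddChar.map_add_eq_mul, pairing_comm b a u, pairing_comm b a v]

/-- Evaluation at the basis vector `b l` recovers the `l`-th coordinate of `u`. -/
theorem pairing_injective : Function.Injective (pairing b) := by
  intro u v huv
  refine b.ext_elem fun l => ?_
  have h := DFunLike.congr_fun huv (b l)
  have key : ∀ w : K, pairing b w (b l) = ZMod.toCircle (b.repr w l) := by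
    intro w
    rw [pairing_apply, Finset.prod_eq_single l]
    · simp
    · intro i _ hi
      simp [hi.symm]
    · simp
  rw [key, key] at h
  exact ZMod.injective_toCircle h

/-- A finite abelian group has as many characters as elements, so injectivity suffices. Surjectivity
is what makes the digits of a character exist. -/
theorem pairing_bijective [Fintype K] : Function.Bijective (pairing b) := by
  classical
  let e : AddChar K Circle ≃ AddChar K ℂ := AddChar.circleEquivComplex.toEquiv
  have := Fintype.ofEquiv _ e.symm
  rw [Fintype.bijective_iff_injective_and_card]
  refine ⟨pairing_injective b, ?_⟩
  rw [Fintype.card_congr e, AddChar.card_eq]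

theorem sum_pairing [Fintype K] [DecidableEq K] (u : K) :
    ∑ a, (pairing b u a : ℂ) = if u = 0 then (Fintype.card K : ℂ) else 0 := by
  classical
  have h := AddChar.sum_eq_ite (AddChar.circleEquivComplex (pairing b u))
  have h1 : AddChar.circleEquivComplex (pairing b u) = 0 ↔ u = 0 := by
    rw [AddEquiv.map_eq_zero_iff]
    refine ⟨fun h0 => pairing_injective b ?_, ?_⟩
    · rw [h0]
      exact (DFunLike.ext _ _ fun a => pairing_zero_left b a).symm
    · rintro rfl
      exact DFunLike.ext _ _ fun a => pairing_zero_left b a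
  simp only [h1] at h
  exact h

/-- Orthogonality on `K^ι`: the sum factors over the coordinates, and a single nonzero `u i` already
gives a zero factor. -/
theorem sum_prod_pairing [Fintype K] {ι : Type*} [Fintype ι] [DecidableEq ι] [DecidableEq K]
    (u : ι → K) :
    ∑ a : ι → K, ∏ i, (pairing b (u i) (a i) : ℂ) =
      if u = 0 then (Fintype.card K : ℂ) ^ Fintype.card ι else 0 := by
  have h := Finset.prod_univ_sum (fun _ : ι => (Finset.univ : Finset K))
    fun i a => (pairing b (u i) a : ℂ)
  rw [Fintype.piFinset_univ] at h
  rw [← h]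
  simp only [sum_pairing]
  split_ifs with hu
  · simp [hu]
  · obtain ⟨i, hi⟩ := Function.ne_iff.1 hu
    exact Finset.prod_eq_zero (Finset.mem_univ i) (if_neg hi)

end Pairing

/-! ### Finite series -/

section Series

variable {K : Type*} [Field K]

theorem dil_single (k n : ℤ) (a : K) :
    dil k (HahnSeries.single n a : LaurentSeries K) = HahnSeries.single (n - k) a := by
  rw [dil, HahnSeries.single_mul_single, one_mul, neg_add_eq_sub]

theorem dil_dil (j k : ℤ) (x : LaurentSeries K) : dil j (dil k x) = dil (j + k) x := by
  ext n
  simp only [coeff_dil]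
  congr 1
  ring

theorem dil_zero (x : LaurentSeries K) : dil 0 x = x := by
  ext n
  simp [coeff_dil]

theorem dil_sub (k : ℤ) (x y : LaurentSeries K) : dil k (x - y) = dil k x - dil k y :=
  mul_sub _ _ _

theorem dil_mem_Ball {k n : ℤ} {x : LaurentSeries K} : dil k x ∈ Ball K n ↔ x ∈ Ball K (n + k) := by
  simp only [mem_Ball, coeff_dil]
  constructor
  · intro h j hj
    have := h (j - k) (by lia)
    rwa [sub_add_cancel] at this
  · intro h j hj
    exact h _ (by lia)

theorem Ball_anti {m n : ℤ} (h : m ≤ n) : Ball K n ≤ Ball K m :=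
  fun _ hx j hj => hx j (by lia)

theorem exists_mem_Ball (x : LaurentSeries K) : ∃ n : ℕ, x ∈ Ball K (-(n : ℤ)) := by
  refine ⟨(-x.order).toNat, fun j hj => HahnSeries.coeff_eq_zero_of_lt_order ?_⟩
  lia

theorem single_mem_Ball {n m : ℤ} (h : m ≤ n) (a : K) :
    (HahnSeries.single n a : LaurentSeries K) ∈ Ball K m := by
  intro j hj
  exact HahnSeries.coeff_single_of_ne (by lia)

/-- The series `c_0 t^n + ... + c_{L-1} t^(n+L-1)`. -/
def finSeries (n : ℤ) {L : ℕ} (c : Fin L → K) : LaurentSeries K :=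
  ∑ i : Fin L, HahnSeries.single (n + (i : ℤ)) (c i)

theorem coeff_finSeries (n : ℤ) {L : ℕ} (c : Fin L → K) (i : Fin L) :
    (finSeries n c).coeff (n + (i : ℤ)) = c i := by
  rw [finSeries, HahnSeries.coeff_sum, Finset.sum_eq_single i]
  · simp
  · intro j _ hj
    refine HahnSeries.coeff_single_of_ne fun h => hj (Fin.ext ?_)
    lia
  · simp

theorem coeff_finSeries_of_lt {n : ℤ} {L : ℕ} (c : Fin L → K) {j : ℤ} (hj : j < n) :
    (finSeries n c).coeff j = 0 := by
  rw [finSeries, HahnSeries.coeff_sum]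
  exact Finset.sum_eq_zero fun i _ => HahnSeries.coeff_single_of_ne (by have := i.2; lia)

theorem coeff_finSeries_of_le {n : ℤ} {L : ℕ} (c : Fin L → K) {j : ℤ} (hj : n + L ≤ j) :
    (finSeries n c).coeff j = 0 := by
  rw [finSeries, HahnSeries.coeff_sum]
  exact Finset.sum_eq_zero fun i _ => HahnSeries.coeff_single_of_ne (by have := i.2; lia)

theorem finSeries_mem_Ball (n : ℤ) {L : ℕ} (c : Fin L → K) : finSeries n c ∈ Ball K n :=
  fun _ hj => coeff_finSeries_of_lt c hj

theorem finSeries_mem_shifts {N : ℕ} (c : Fin N → K) : finSeries (-(N : ℤ)) c ∈ shifts K :=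
  fun _ hj => coeff_finSeries_of_le c (by lia)

/-- A series in `Ball K n` agrees with its truncation up to an element of `Ball K (n + L)`. -/
theorem sub_finSeries_mem {n : ℤ} (L : ℕ) {x : LaurentSeries K} (hx : x ∈ Ball K n) :
    x - finSeries n (fun i : Fin L => x.coeff (n + (i : ℤ))) ∈ Ball K (n + L) := by
  intro j hj
  rw [HahnSeries.coeff_sub]
  rcases lt_or_ge j n with h | h
  · rw [hx j h, coeff_finSeries_of_lt _ h, sub_zero]
  · obtain ⟨i, rfl⟩ : ∃ i : ℕ, j = n + i := ⟨(j - n).toNat, by lia⟩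
    have := coeff_finSeries n (fun i : Fin L => x.coeff (n + (i : ℤ))) ⟨i, by lia⟩
    simp only at this
    rw [this, sub_self]

theorem shiftElt_mem_shifts {n : ℕ} (c : Fin n → K) : shiftElt c ∈ shifts K := by
  intro j hj
  rw [shiftElt, HahnSeries.coeff_sum]
  exact Finset.sum_eq_zero fun i _ => HahnSeries.coeff_single_of_ne (by have := i.2; lia)

theorem shiftElt_mem_Ball {n : ℕ} (c : Fin n → K) : shiftElt c ∈ Ball K (-(n : ℤ)) := by
  intro j hj
  rw [shiftElt, HahnSeries.coeff_sum]
  exact Finset.sum_eq_zero fun i _ => HahnSeries.coeff_single_of_ne (by have := i.2; lia)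

end Series

/-! ### Digits of characters -/

/-- Every character is trivial on some ball. -/
theorem exists_mem_annihilator {p : ℕ} [Fact p.Prime] {K : Type*} [Field K] [CharP K p]
    (χ : Characters K) :
    ∃ n : ℕ, χ ∈ annihilator (Ball K (n : ℤ)) := by
  have hp : p ≠ 0 := (Fact.out : p.Prime).ne_zero
  -- The values of `χ` are `p`-th roots of unity, a finite set, so some neighbourhood of `1`
  -- contains no other possible value; continuity at zero then forces `χ = 1` on a ball.
  have hroots : {z : Circle | z ^ p = 1}.Finite := by
    have h1 : {z : ℂ | z ^ p = 1}.Finite := by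
      refine (Polynomial.nthRoots p (1 : ℂ)).toFinset.finite_toSet.subset fun z hz => ?_
      simpa [Polynomial.mem_nthRoots (Nat.pos_of_ne_zero hp)] using hz
    refine Set.Finite.of_finite_image (f := ((↑) : Circle → ℂ)) (h1.subset ?_)
      Circle.coe_injective.injOn
    rintro _ ⟨z, hz, rfl⟩
    have := congrArg ((↑) : Circle → ℂ) (show z ^ p = 1 from hz)
    simpa using this
  have hU : ({z : Circle | z ^ p = 1} \ {1})ᶜ ∈ 𝓝 (1 : Circle) :=
    (hroots.sdiff (t := {1})).isClosed.isOpen_compl.mem_nhds (by simp)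
  have hcont : ContinuousAt (χ : AddChar (LaurentSeries K) Circle) 0 := χ.2.continuousAt
  have h2 := hcont (by rwa [AddChar.map_zero_eq_one])
  obtain ⟨n, hn⟩ := exists_Ball_subset h2
  refine ⟨n.toNat, fun x hx => ?_⟩
  have h3 := hn (Ball_anti (Int.self_le_toNat n) hx)
  by_contra hne
  refine h3 ⟨?_, hne⟩
  show (χ : AddChar (LaurentSeries K) Circle) x ^ p = 1
  rw [← AddChar.map_nsmul_eq_pow]
  have : p • x = 0 := by
    rw [nsmul_eq_mul, ← map_natCast (HahnSeries.C (Γ := ℤ) (R := K)), CharP.cast_eq_zero, map_zero,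
      zero_mul]
  rw [this, AddChar.map_zero_eq_one]

section MkChar

variable {p s : ℕ} [Fact p.Prime] {K : Type*} [Field K] [Algebra (ZMod p) K]
  (b : Module.Basis (Fin s) (ZMod p) K)

theorem rad_apply (k : ℤ) (u : K) (x : LaurentSeries K) :
    (rad b k u : AddChar (LaurentSeries K) Circle) x = pairing b u (x.coeff k) := rfl

/-- The character `r_n^{c_0} r_{n+1}^{c_1} ⋯ r_{n+L-1}^{c_{L-1}}`. -/
def mkChar (n : ℤ) {L : ℕ} (c : Fin L → K) : Characters K :=
  ∏ i : Fin L, rad b (n + i) (c i)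

theorem mkChar_snoc (n : ℤ) {L : ℕ} (c : Fin L → K) (a : K) :
    mkChar b n (Fin.snoc c a : Fin (L + 1) → K) = mkChar b n c * rad b (n + L) a := by
  simp [mkChar, Fin.prod_univ_castSucc]

theorem apply_mkChar (n : ℤ) {L : ℕ} (c : Fin L → K) (x : LaurentSeries K) :
    (mkChar b n c : AddChar (LaurentSeries K) Circle) x =
      ∏ i : Fin L, pairing b (c i) (x.coeff (n + (i : ℤ))) := by
  have : ∀ (S : Finset (Fin L)), ((∏ i ∈ S, rad b (n + i) (c i) : Characters K) :
      AddChar (LaurentSeries K) Circle) x = ∏ i ∈ S, pairing b (c i) (x.coeff (n + (i : ℤ))) := by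
    intro S
    induction S using Finset.induction_on with
    | empty => simp
    | insert i S hi ih =>
      rw [Finset.prod_insert hi, Finset.prod_insert hi, ← ih]
      rfl
  exact this _

end MkChar

section Digits

variable {p s : ℕ} [Fact p.Prime] {K : Type*} [Field K] [Fintype K] [Algebra (ZMod p) K]
  (b : Module.Basis (Fin s) (ZMod p) K)

/-- The restriction of a character to the series `a t^k`. -/
def restrictChar (χ : Characters K) (k : ℤ) : AddChar K Circle :=
  ((χ : AddChar (LaurentSeries K) Circle)).compAddMonoidHom
    (HahnSeries.single.addMonoidHom k : K →+ LaurentSeries K)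

/-- The exponent `u` of the factor `r_k^u` of a character. -/
def digit (χ : Characters K) (k : ℤ) : K :=
  (Equiv.ofBijective _ (pairing_bijective b)).symm (restrictChar χ k)

theorem apply_single (χ : Characters K) (k : ℤ) (a : K) :
    (χ : AddChar (LaurentSeries K) Circle) (HahnSeries.single k a) =
      pairing b (digit b χ k) a := by
  have h : pairing b (digit b χ k) = restrictChar χ k :=
    (Equiv.ofBijective _ (pairing_bijective b)).apply_symm_apply _
  rw [h]
  rfl

theorem digit_eq {χ : Characters K} {k : ℤ} {u : K}
    (h : ∀ a, (χ : AddChar (LaurentSeries K) Circle) (HahnSeries.single k a) = pairing b u a) :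
    digit b χ k = u := by
  refine pairing_injective b (DFunLike.ext _ _ fun a => ?_)
  rw [← h, apply_single b]

theorem digit_one (k : ℤ) : digit b 1 k = 0 :=
  digit_eq b fun a => (pairing_zero_left b a).symm

theorem digit_mul (χ ψ : Characters K) (k : ℤ) :
    digit b (χ * ψ) k = digit b χ k + digit b ψ k := by
  refine digit_eq b fun a => ?_
  rw [pairing_add_left, ← apply_single, ← apply_single]
  rfl

theorem digit_inv (χ : Characters K) (k : ℤ) : digit b χ⁻¹ k = -digit b χ k := by
  have h := digit_mul b χ χ⁻¹ k
  rw [mul_inv_cancel, digit_one] at h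
  exact eq_neg_of_add_eq_zero_right h.symm

theorem digit_prod {ι : Type*} (S : Finset ι) (χ : ι → Characters K) (k : ℤ) :
    digit b (∏ i ∈ S, χ i) k = ∑ i ∈ S, digit b (χ i) k := by
  classical
  induction S using Finset.induction_on with
  | empty => simp [digit_one]
  | insert i S hi ih => rw [Finset.prod_insert hi, Finset.sum_insert hi, digit_mul, ih]

theorem digit_rad (k j : ℤ) (u : K) : digit b (rad b k u) j = if j = k then u else 0 := by
  refine digit_eq b fun a => ?_
  rw [rad_apply]
  split_ifs with h
  · rw [h, HahnSeries.coeff_single_same]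
  · rw [HahnSeries.coeff_single_of_ne (Ne.symm h), AddChar.map_zero_eq_one, pairing_zero_left]

theorem digit_dilChar (χ : Characters K) (m k : ℤ) :
    digit b (dilChar χ m) k = digit b χ (k - m) := by
  refine digit_eq b fun a => ?_
  rw [← apply_single]
  show (χ : AddChar (LaurentSeries K) Circle) (dil m _) = _
  rw [dil_single]

theorem AddChar_map_sum {A M ι : Type*} [AddCommMonoid A] [CommMonoid M] (ψ : AddChar A M)
    (S : Finset ι) (f : ι → A) : ψ (∑ i ∈ S, f i) = ∏ i ∈ S, ψ (f i) := by
  classical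
  induction S using Finset.induction_on with
  | empty => simp
  | insert i S hi ih => rw [Finset.prod_insert hi, Finset.sum_insert hi, AddChar.map_add_eq_mul, ih]

theorem apply_finSeries (χ : Characters K) (n : ℤ) {L : ℕ} (c : Fin L → K) :
    (χ : AddChar (LaurentSeries K) Circle) (finSeries n c) =
      ∏ i : Fin L, pairing b (digit b χ (n + i)) (c i) := by
  rw [finSeries, AddChar_map_sum]
  exact Finset.prod_congr rfl fun i _ => apply_single b _ _ _

/-- The tail of `x` beyond its first `L` coefficients lies in the ball on which `χ` is trivial. -/
theorem apply_of_mem_annihilator {χ : Characters K} {n : ℤ} {L : ℕ}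
    (hχ : χ ∈ annihilator (Ball K (n + L))) {x : LaurentSeries K} (hx : x ∈ Ball K n) :
    (χ : AddChar (LaurentSeries K) Circle) x =
      ∏ i : Fin L, pairing b (digit b χ (n + i)) (x.coeff (n + (i : ℤ))) := by
  rw [← apply_finSeries, ← sub_add_cancel x (finSeries n fun i : Fin L => x.coeff (n + (i : ℤ))),
    AddChar.map_add_eq_mul, hχ _ (sub_finSeries_mem L hx), one_mul, sub_add_cancel]

/-- Monomials give one direction. Conversely `χ` is trivial on some ball, so its values on `F_n`
involve only finitely many digits, all of index at least `n`. This reduces every statement on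
annihilators to digits. -/
theorem mem_annihilator_iff {χ : Characters K} {n : ℤ} :
    χ ∈ annihilator (Ball K n) ↔ ∀ k, n ≤ k → digit b χ k = 0 := by
  have : CharP K p := charP_of_injective_algebraMap (algebraMap (ZMod p) K).injective p
  constructor
  · intro h k hk
    refine digit_eq b fun a => ?_
    rw [pairing_zero_left]
    exact h _ (single_mem_Ball hk a)
  · intro h x hx
    obtain ⟨m, hm⟩ := exists_mem_annihilator (p := p) χ
    have hm' : χ ∈ annihilator (Ball K (n + ((m : ℤ) - n).toNat)) :=
      fun y hy => hm y (Ball_anti (by lia) hy)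
    rw [apply_of_mem_annihilator b hm' hx]
    refine Finset.prod_eq_one fun i _ => ?_
    rw [h _ (by lia), pairing_zero_left]

theorem exists_digit_eq_zero (χ : Characters K) : ∃ n : ℕ, ∀ k : ℤ, n ≤ k → digit b χ k = 0 := by
  have : CharP K p := charP_of_injective_algebraMap (algebraMap (ZMod p) K).injective p
  obtain ⟨n, hn⟩ := exists_mem_annihilator (p := p) χ
  exact ⟨n, (mem_annihilator_iff b).1 hn⟩

theorem digit_mkChar (n : ℤ) {L : ℕ} (c : Fin L → K) (i : Fin L) :
    digit b (mkChar b n c) (n + i) = c i := by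
  rw [mkChar, digit_prod, Finset.sum_eq_single i]
  · simp [digit_rad]
  · intro j _ hj
    rw [digit_rad, if_neg]
    intro h
    exact hj (Fin.ext (by lia))
  · simp

theorem digit_mkChar_of_le (n : ℤ) {L : ℕ} (c : Fin L → K) {j : ℤ} (hj : n + L ≤ j) :
    digit b (mkChar b n c) j = 0 := by
  rw [mkChar, digit_prod]
  refine Finset.sum_eq_zero fun i _ => ?_
  rw [digit_rad, if_neg (by have := i.2; lia)]

end Digits

/-! ### The infinite product -/

section Dilation

variable {K : Type*} [Field K]

theorem maskProduct_eq_prod {m₀ : Characters K → ℂ} {χ : Characters K} {n : ℕ}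
    (hn : ∀ k ≥ n, m₀ (dilChar χ (-(k : ℤ))) = 1) :
    maskProduct m₀ χ = ∏ k ∈ Finset.range n, m₀ (dilChar χ (-(k : ℤ))) :=
  tprod_eq_prod fun k hk => hn k (by simpa using hk)

theorem dilChar_dilChar (χ : Characters K) (j k : ℤ) :
    dilChar (dilChar χ j) k = dilChar χ (j + k) := by
  refine Subtype.ext (DFunLike.ext _ _ fun x => ?_)
  show (χ : AddChar (LaurentSeries K) Circle) (dil j (dil k x)) =
    (χ : AddChar (LaurentSeries K) Circle) (dil (j + k) x)
  rw [dil_dil]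

theorem dilChar_zero (χ : Characters K) : dilChar χ 0 = χ := by
  refine Subtype.ext (DFunLike.ext _ _ fun x => ?_)
  show (χ : AddChar (LaurentSeries K) Circle) (dil 0 x) = _
  rw [dil_zero]

end Dilation

section MaskProduct

variable {p s : ℕ} [Fact p.Prime] {K : Type*} [Field K] [Fintype K] [Algebra (ZMod p) K]
  {b : Module.Basis (Fin s) (ZMod p) K} {N : ℕ} {m₀ : Characters K → ℂ}

/-- A mask depends on finitely many digits only. -/
theorem IsMask.congr (b : Module.Basis (Fin s) (ZMod p) K) (h : IsMask N m₀)
    {χ ψ : Characters K}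
    (hd : ∀ k : ℤ, -(N : ℤ) ≤ k → k ≤ 0 → digit b χ k = digit b ψ k) : m₀ χ = m₀ ψ := by
  obtain ⟨β, hβ⟩ := h
  rw [hβ, hβ]
  congr 1
  refine Finset.sum_congr rfl fun c _ => ?_
  congr 2
  rw [ev, ev, shiftElt, AddChar_map_sum, AddChar_map_sum]
  congr 1
  refine Finset.prod_congr rfl fun i _ => ?_
  -- The shift coefficient at `t^{-(i+1)}` is paired by `χA^{-1}` with the digit `-i`, where `0 ≤ i
  -- ≤ N`.
  have := i.2
  rw [apply_single b, apply_single b, digit_dilChar, digit_dilChar, hd _ (by lia) (by lia)]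

/-- The digits `k - N, ..., k - 1` of a character. -/
def window (b : Module.Basis (Fin s) (ZMod p) K) (N : ℕ) (χ : Characters K) (k : ℕ) : Fin N → K :=
  fun i => digit b χ ((k : ℤ) - N + i)

/-- The dictionary between the product and the digraph: the `k`-th factor only sees the digits `k-N,
..., k` of `χ`, because dilation shifts them to `-N, ..., 0`. -/
theorem IsMask.norm_sq_dilChar (h : IsMask N m₀) (χ : Characters K) (k : ℕ) :
    ‖m₀ (dilChar χ (-(k : ℤ)))‖ ^ 2 =
      lam b m₀ (Fin.snoc (window b N χ k) (digit b χ k) : Fin (N + 1) → K) := by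
  rw [lam]
  congr 2
  refine h.congr b fun j hj hj0 => ?_
  obtain ⟨i, rfl⟩ : ∃ i : Fin (N + 1), j = -(N : ℤ) + i :=
    ⟨⟨(j + N).toNat, by lia⟩, by simp only; lia⟩
  have h1 : ∀ c : Fin (N + 1) → K,
      ∏ i : Fin (N + 1), rad b ((i : ℤ) - N) (c i) = mkChar b (-(N : ℤ)) c := by
    intro c
    rw [mkChar]
    refine Finset.prod_congr rfl fun i _ => ?_
    rw [neg_add_eq_sub]
  rw [h1, digit_mkChar, digit_dilChar]
  refine Fin.lastCases ?_ (fun i => ?_) i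
  · simp
  · rw [Fin.snoc_castSucc, window]
    congr 1
    simp only [Fin.val_castSucc]
    ring

/-- Consecutive windows overlap in the way that arcs of the array digraph prescribe. -/
theorem tail_snoc_window (χ : Characters K) (k : ℕ) :
    Fin.tail (Fin.snoc (window b N χ k) (digit b χ k) : Fin (N + 1) → K) =
      window b N χ (k + 1) := by
  funext i
  rw [Fin.tail]
  rcases lt_or_ge ((i : ℕ) + 1) N with h | h
  · have : i.succ = Fin.castSucc ⟨i + 1, h⟩ := rfl
    rw [this, Fin.snoc_castSucc, window, window]
    congr 1
    push_cast
    ring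
  · have hi := i.2
    have : i.succ = Fin.last N := Fin.ext (by simp; lia)
    rw [this, Fin.snoc_last, window]
    congr 1
    push_cast
    lia

theorem IsAdapted.eq_one_of_digit {Γ : Digraph (Fin N → K)} (hm₀ : IsAdapted b Γ m₀)
    {χ : Characters K} {k : ℕ} (h : ∀ j : ℤ, (k : ℤ) - N ≤ j → digit b χ j = 0) :
    m₀ (dilChar χ (-(k : ℤ))) = 1 := by
  refine hm₀.eq_one _ ((mem_annihilator_iff b).2 fun j hj => ?_)
  rw [digit_dilChar]
  exact h _ (by lia)

theorem IsAdapted.exists_forall_eq_one {Γ : Digraph (Fin N → K)} (hm₀ : IsAdapted b Γ m₀)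
    (χ : Characters K) : ∃ n : ℕ, ∀ k ≥ n, m₀ (dilChar χ (-(k : ℤ))) = 1 := by
  obtain ⟨n, hn⟩ := exists_digit_eq_zero b χ
  exact ⟨n + N, fun k hk => hm₀.eq_one_of_digit fun j hj => hn j (by lia)⟩

theorem IsAdapted.multipliable {Γ : Digraph (Fin N → K)} (hm₀ : IsAdapted b Γ m₀)
    (χ : Characters K) : Multipliable fun k : ℕ => m₀ (dilChar χ (-(k : ℤ))) := by
  obtain ⟨n, hn⟩ := hm₀.exists_forall_eq_one χ
  exact multipliable_of_ne_finset_one (s := Finset.range n) fun k hk => hn k (by simpa using hk)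

/-- Splitting off the factor `k = 0`; this is the refinement equation on the Fourier side. -/
theorem IsAdapted.maskProduct_succ {Γ : Digraph (Fin N → K)} (hm₀ : IsAdapted b Γ m₀)
    (χ : Characters K) : maskProduct m₀ χ = m₀ χ * maskProduct m₀ (dilChar χ (-1)) := by
  obtain ⟨n, hn⟩ := hm₀.exists_forall_eq_one χ
  have h1 : ∀ k : ℕ, dilChar (dilChar χ (-1)) (-(k : ℤ)) = dilChar χ (-((k + 1 : ℕ) : ℤ)) := by
    intro k
    rw [dilChar_dilChar]
    congr 1
    push_cast
    ring
  rw [maskProduct_eq_prod (n := n + 1) fun k hk => hn k (by lia),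
    maskProduct_eq_prod (χ := dilChar χ (-1)) (n := n) fun k hk => by
      rw [h1]; exact hn _ (by lia), Finset.prod_range_succ', mul_comm]
  simp only [h1]
  congr 1
  simp [dilChar_zero]

/-- The factor with index `k ≥ 0` looks at digits of index at least `k - N ≥ -N`. -/
theorem IsMask.maskProduct_congr (b : Module.Basis (Fin s) (ZMod p) K) (h : IsMask N m₀)
    {χ ψ : Characters K} (hd : ∀ k : ℤ, -(N : ℤ) ≤ k → digit b χ k = digit b ψ k) :
    maskProduct m₀ χ = maskProduct m₀ ψ := by
  refine tprod_congr fun k => h.congr b fun j hj _ => ?_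
  rw [digit_dilChar, digit_dilChar]
  exact hd _ (by lia)

/-! ### The mask product along paths of the digraph. -/

section Tree

variable {V : Type*} {T : RTree V} {lab : V → K} {hT : T.NValid lab N}

/-- Each nonzero factor forces an arc of `Γ` between consecutive windows, which costs a level,
unless window and next digit are zero. In that case the level is `0`, which agrees with the
truncated subtraction once `k` exceeds the height. -/
theorem IsAdapted.level_window (hm₀ : IsAdapted b (arrayDigraph hT.derivedTree) m₀)
    (h : IsMask N m₀) {χ : Characters K} {n : ℕ}
    (hχ : ∀ k < n, m₀ (dilChar χ (-(k : ℤ))) ≠ 0) {k : ℕ} (hk : k ≤ n) :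
    hT.derivedTree.level (window b N χ k) ≤ hT.derivedTree.height - k := by
  induction k with
  | zero => exact hT.derivedTree.level_le_height _
  | succ k ih =>
    have ih := ih (by lia)
    have h1 : lam b m₀ (Fin.snoc (window b N χ k) (digit b χ k) : Fin (N + 1) → K) ≠ 0 := by
      rw [← h.norm_sq_dilChar]
      exact pow_ne_zero 2 (norm_ne_zero_iff.2 (hχ k (by lia)))
    by_cases h2 : window b N χ k ≠ 0 ∨ digit b χ k ≠ 0
    · have h3 : (arrayDigraph hT.derivedTree).Adj (window b N χ k) (window b N χ (k + 1)) := by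
        by_contra h3
        refine h1 (hm₀.eq_zero _ _ h2 ?_)
        rwa [tail_snoc_window]
      have := h3.1
      lia
    · push Not at h2
      have h3 : window b N χ (k + 1) = 0 := by
        rw [← tail_snoc_window, h2.1, h2.2]
        funext i
        rw [Fin.tail]
        refine Fin.lastCases ?_ (fun i => ?_) i.succ <;> simp
      rw [h3]
      have : hT.derivedTree.level 0 = 0 := hT.derivedTree.level_root
      lia

theorem IsAdapted.window_eq_zero (hm₀ : IsAdapted b (arrayDigraph hT.derivedTree) m₀)
    (h : IsMask N m₀) {χ : Characters K} {n : ℕ}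
    (hχ : ∀ k < n, m₀ (dilChar χ (-(k : ℤ))) ≠ 0) (hn : hT.derivedTree.height ≤ n) :
    window b N χ n = 0 := by
  have h1 := hm₀.level_window h hχ le_rfl
  have h2 : hT.derivedTree.level (window b N χ n) = 0 := by lia
  exact RTree.level_eq_zero.1 h2

theorem IsAdapted.digit_eq_zero (hN : 1 ≤ N)
    (hm₀ : IsAdapted b (arrayDigraph hT.derivedTree) m₀)
    (h : IsMask N m₀) {χ : Characters K} (hχ : maskProduct m₀ χ ≠ 0) {j : ℤ}
    (hj : (hT.derivedTree.height : ℤ) - N ≤ j) : digit b χ j = 0 := by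
  obtain ⟨n, hn⟩ := hm₀.exists_forall_eq_one χ
  rw [maskProduct_eq_prod hn, Finset.prod_ne_zero_iff] at hχ
  have hall : ∀ k : ℕ, m₀ (dilChar χ (-(k : ℤ))) ≠ 0 := by
    intro k
    rcases lt_or_ge k n with hk | hk
    · exact hχ k (Finset.mem_range.2 hk)
    · rw [hn k hk]
      exact one_ne_zero
  -- The digit `j` is the first entry of the window with index `j + N`, and this index is at least
  -- the height.
  have h1 := hm₀.window_eq_zero h (n := (j + N).toNat) (fun k _ => hall k) (by lia)
  have h2 := congrFun h1 ⟨0, hN⟩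
  rw [window, Pi.zero_apply] at h2
  convert h2 using 2
  simp only [Nat.cast_zero]
  lia

theorem IsAdapted.maskProduct_mem_dualStepFun (hN : 1 ≤ N)
    (hm₀ : IsAdapted b (arrayDigraph hT.derivedTree) m₀) (h : IsMask N m₀) :
    maskProduct m₀ ∈ dualStepFun (K := K) (-(N : ℤ)) ((hT.derivedTree.height : ℤ) - N) := by
  refine ⟨fun χ ψ hψ => h.maskProduct_congr b fun k hk => ?_, fun χ hχ => ?_⟩
  · rw [digit_mul, (mem_annihilator_iff b).1 hψ k hk, add_zero]
  · exact (mem_annihilator_iff b).2 fun k hk => hm₀.digit_eq_zero hN h hχ hk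

/-- For a character with sufficiently few digits, the infinite product is determined by its first
factors. -/
theorem IsAdapted.maskProduct_eq_prod_height (hm₀ : IsAdapted b (arrayDigraph hT.derivedTree) m₀)
    (h : IsMask N m₀) {χ : Characters K}
    (hχ : ∀ j : ℤ, (hT.derivedTree.height : ℤ) ≤ j → digit b χ j = 0) :
    maskProduct m₀ χ =
      ∏ k ∈ Finset.range hT.derivedTree.height, m₀ (dilChar χ (-(k : ℤ))) := by
  set H := hT.derivedTree.height with hH
  obtain ⟨n, hn⟩ := hm₀.exists_forall_eq_one χ
  -- The range `n + H` is long enough both for the convergence and to contain the first `H` factors.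
  -- If one of those vanishes, both sides are zero; otherwise the window at `H` is zero and the
  -- later factors are one.
  rw [maskProduct_eq_prod (n := n + H) fun k hk => hn k (by lia)]
  by_cases h0 : ∏ k ∈ Finset.range H, m₀ (dilChar χ (-(k : ℤ))) = 0
  · rw [h0]
    obtain ⟨k, hk, hk0⟩ := Finset.prod_eq_zero_iff.1 h0
    refine Finset.prod_eq_zero ?_ hk0
    rw [Finset.mem_range] at hk ⊢
    lia
  · rw [← ne_eq, Finset.prod_ne_zero_iff] at h0
    have hw := hm₀.window_eq_zero h (n := H) (fun k hk => h0 k (Finset.mem_range.2 hk)) le_rfl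
    have hd : ∀ j : ℤ, (H : ℤ) - N ≤ j → digit b χ j = 0 := by
      intro j hj
      rcases lt_or_ge j H with hlt | hge
      · have h3 := congrFun hw ⟨(j + N - H).toNat, by lia⟩
        rw [window, Pi.zero_apply] at h3
        convert h3 using 2
        simp only
        lia
      · exact hχ j hge
    refine (Finset.prod_subset (Finset.range_mono (by lia)) fun k _ hk => ?_).symm
    rw [Finset.mem_range, not_lt] at hk
    exact hm₀.eq_one_of_digit fun j hj => hd j (by lia)

/-- If the digits with indices between `-N` and `-1` vanish, the infinite product vanishes
unless all digits with indices at least `-N` do. -/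
theorem IsAdapted.maskProduct_of_window_zero (hm₀ : IsAdapted b (arrayDigraph hT.derivedTree) m₀)
    {χ : Characters K} (h : IsMask N m₀) (hw : window b N χ 0 = 0)
    (hχ : ∃ j : ℤ, -(N : ℤ) ≤ j ∧ digit b χ j ≠ 0) : maskProduct m₀ χ = 0 := by
  by_contra hne
  obtain ⟨n, hn⟩ := hm₀.exists_forall_eq_one χ
  rw [maskProduct_eq_prod hn, ← ne_eq, Finset.prod_ne_zero_iff] at hne
  have hall : ∀ k : ℕ, m₀ (dilChar χ (-(k : ℤ))) ≠ 0 := by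
    intro k
    rcases lt_or_ge k n with hk | hk
    · exact hne k (Finset.mem_range.2 hk)
    · rw [hn k hk]
      exact one_ne_zero
  -- By induction the window stays zero: a nonzero next digit would need an arc out of the zero
  -- array.
  have hstep : ∀ k : ℕ, window b N χ k = 0 ∧ ∀ j < k, digit b χ (j : ℤ) = 0 := by
    intro k
    induction k with
    | zero => exact ⟨hw, fun j hj => absurd hj (Nat.not_lt_zero j)⟩
    | succ k ih =>
      have h1 : lam b m₀ (Fin.snoc (window b N χ k) (digit b χ k) : Fin (N + 1) → K) ≠ 0 := by
        rw [← h.norm_sq_dilChar]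
        exact pow_ne_zero 2 (norm_ne_zero_iff.2 (hall k))
      have h2 : digit b χ k = 0 := by
        by_contra h2
        refine h1 (hm₀.eq_zero _ _ (Or.inr h2) ?_)
        rw [ih.1]
        exact hT.not_arrayDigraph_adj_zero _
      refine ⟨?_, fun j hj => ?_⟩
      · rw [← tail_snoc_window, ih.1, h2]
        funext i
        rw [Fin.tail]
        refine Fin.lastCases ?_ (fun i => ?_) i.succ <;> simp
      · rcases Nat.lt_succ_iff_lt_or_eq.1 hj with hj | rfl
        · exact ih.2 j hj
        · exact h2
  obtain ⟨j, hj, hj0⟩ := hχ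
  refine hj0 ?_
  rcases lt_or_ge j 0 with hlt | hge
  · have h3 := congrFun hw ⟨(j + N).toNat, by lia⟩
    rw [window, Pi.zero_apply] at h3
    convert h3 using 2
    simp only
    lia
  · have := (hstep (j.toNat + 1)).2 j.toNat (by lia)
    rwa [Int.toNat_of_nonneg hge] at this

theorem IsAdapted.maskProduct_of_digit_zero {Γ : Digraph (Fin N → K)} (hm₀ : IsAdapted b Γ m₀)
    {χ : Characters K} (hχ : ∀ j : ℤ, -(N : ℤ) ≤ j → digit b χ j = 0) : maskProduct m₀ χ = 1 := by
  rw [maskProduct_eq_prod (n := 0), Finset.range_zero, Finset.prod_empty]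
  exact fun k _ => hm₀.eq_one_of_digit fun j hj => hχ j (by lia)

/-- Summing the squares of the partial products over all values of the digits with nonnegative
indices. -/
theorem IsAdapted.sum_prod_norm_sq (hm₀ : IsAdapted b (arrayDigraph hT.derivedTree) m₀)
    (h : IsMask N m₀) (g : (Fin N → K) → ℂ) (L : ℕ) :
    ∑ c : Fin (N + L) → K,
      (((∏ k ∈ Finset.range L, ‖m₀ (dilChar (mkChar b (-(N : ℤ)) c) (-(k : ℤ)))‖ ^ 2 : ℝ)) : ℂ) *
        g (window b N (mkChar b (-(N : ℤ)) c) 0) = ∑ A, g A := by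
  induction L with
  | zero =>
    refine Finset.sum_congr rfl fun c _ => ?_
    have : window b N (mkChar b (-(N : ℤ)) c) 0 = c := by
      funext i
      rw [window, Nat.cast_zero, zero_sub]
      exact digit_mkChar b _ c i
    rw [this]
    simp
  | succ L ih =>
    -- The digit of highest index `L` is summed first: only the factor `k = L` depends on it, and
    -- over its values the `λ` of that factor sum to one.
    have hsnoc : ∀ F : (Fin (N + L + 1) → K) → ℂ,
        ∑ c, F c = ∑ c : Fin (N + L) → K, ∑ a : K, F (Fin.snoc c a) := by
      intro F
      rw [← (Fin.snocEquiv fun _ : Fin (N + L + 1) => K).sum_comp F, Fintype.sum_prod_type_right]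
      rfl
    rw [← ih]
    refine (hsnoc _).trans (Finset.sum_congr rfl fun c _ => ?_)
    set χ := mkChar b (-(N : ℤ)) c with hχ
    have hd : ∀ (a : K) (j : ℤ), digit b (mkChar b (-(N : ℤ)) (Fin.snoc c a : Fin (N + L + 1) → K)) j
        = digit b χ j + if j = L then a else 0 := by
      intro a j
      rw [mkChar_snoc, digit_mul, digit_rad]
      congr 2
      apply propext
      constructor <;> intro h <;> push_cast at * <;> lia
    have hL : ∀ a : K, ∀ k ≤ L,
        window b N (mkChar b (-(N : ℤ)) (Fin.snoc c a : Fin (N + L + 1) → K)) k =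
          window b N χ k := by
      intro a k hk
      funext i
      have := i.2
      rw [window, window, hd, if_neg (by lia), add_zero]
    have hdL : digit b χ (L : ℤ) = 0 := digit_mkChar_of_le b _ c (by push_cast; lia)
    have hk : ∀ a : K, ∀ k < L,
        ‖m₀ (dilChar (mkChar b (-(N : ℤ)) (Fin.snoc c a : Fin (N + L + 1) → K)) (-(k : ℤ)))‖ ^ 2 =
          ‖m₀ (dilChar χ (-(k : ℤ)))‖ ^ 2 := by
      intro a k hk
      rw [h.norm_sq_dilChar (b := b), h.norm_sq_dilChar (b := b), hL a k hk.le, hd,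
        if_neg (by lia), add_zero]
    have hlast : ∀ a : K,
        ‖m₀ (dilChar (mkChar b (-(N : ℤ)) (Fin.snoc c a : Fin (N + L + 1) → K)) (-(L : ℤ)))‖ ^ 2 =
          lam b m₀ (Fin.snoc (window b N χ L) a : Fin (N + 1) → K) := by
      intro a
      rw [h.norm_sq_dilChar (b := b), hL a L le_rfl, hd, if_pos rfl, hdL, zero_add]
    have hsum := hm₀.sum_lam (window b N χ L)
    calc _ = ∑ a : K, ((lam b m₀ (Fin.snoc (window b N χ L) a : Fin (N + 1) → K) : ℝ) : ℂ) *
          ((((∏ k ∈ Finset.range L, ‖m₀ (dilChar χ (-(k : ℤ)))‖ ^ 2 : ℝ)) : ℂ) *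
            g (window b N χ 0)) := by
          refine Finset.sum_congr rfl fun a _ => ?_
          have h1 : ∏ k ∈ Finset.range (L + 1), ‖m₀ (dilChar (mkChar b (-(N : ℤ))
              (Fin.snoc c a : Fin (N + L + 1) → K)) (-(k : ℤ)))‖ ^ 2 =
              (∏ k ∈ Finset.range L, ‖m₀ (dilChar χ (-(k : ℤ)))‖ ^ 2) *
                lam b m₀ (Fin.snoc (window b N χ L) a : Fin (N + 1) → K) := by
            rw [Finset.prod_range_succ, hlast]
            congr 1
            exact Finset.prod_congr rfl fun k hk' => hk a k (Finset.mem_range.1 hk')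
          rw [← mul_assoc, ← Complex.ofReal_mul, mul_comm (lam _ _ _), ← h1]
          exact congrArg _ (congrArg g (hL a 0 (Nat.zero_le _)))
      _ = _ := by
          rw [← Finset.sum_mul, ← Complex.ofReal_sum, hsum, Complex.ofReal_one, one_mul]

end Tree

end MaskProduct

/-! ### Topology and Haar measure -/

section Topology

variable {K : Type*} [Field K]

theorem isOpen_Ball (n : ℤ) : IsOpen (Ball K n : Set (LaurentSeries K)) :=
  AddSubgroup.isOpen_of_mem_nhds _ (Ball_mem_nhds n)

theorem measurableSet_Ball (n : ℤ) : MeasurableSet (Ball K n : Set (LaurentSeries K)) :=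
  (isOpen_Ball n).measurableSet

theorem iUnion_Ball : ⋃ n : ℕ, (Ball K (-(n : ℤ)) : Set (LaurentSeries K)) = Set.univ :=
  Set.eq_univ_of_forall fun x => Set.mem_iUnion.2 (exists_mem_Ball x)

/-- The dilation as a homeomorphism. -/
def dilEquiv (k : ℤ) : LaurentSeries K ≃ₜ+ LaurentSeries K where
  toFun := dil k
  invFun := dil (-k)
  left_inv x := by rw [dil_dil, neg_add_cancel, dil_zero]
  right_inv x := by rw [dil_dil, add_neg_cancel, dil_zero]
  map_add' := dil_add k
  continuous_toFun := continuous_dil k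
  continuous_invFun := continuous_dil (-k)

theorem isCompact_Ball [Finite K] (n : ℤ) : IsCompact (Ball K n : Set (LaurentSeries K)) := by
  have h : (Ball K n : Set (LaurentSeries K)) = dil n ⁻¹' (Ball K 0) := by
    ext x
    rw [Set.mem_preimage, SetLike.mem_coe, SetLike.mem_coe, dil_mem_Ball, zero_add]
  rw [h]
  exact (dilEquiv n).toHomeomorph.isCompact_preimage.2 isCompact_Ball_zero

instance locallyCompactSpace [Finite K] : LocallyCompactSpace (LaurentSeries K) :=
  isCompact_Ball_zero.locallyCompactSpace_of_mem_nhds_of_addGroup (Ball_mem_nhds 0)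

instance isAddHaarMeasure_haar [Finite K] : (haar K).IsAddHaarMeasure := by
  unfold haar
  infer_instance

instance regular_haar [Finite K] : (haar K).Regular := by
  unfold haar
  infer_instance

theorem haar_Ball_zero [Finite K] : haar K (Ball K 0) = 1 :=
  Measure.addHaarMeasure_self (K₀ := ⟨⟨(Ball K 0 : Set (LaurentSeries K)), isCompact_Ball_zero⟩,
    interior_Ball_nonempty 0⟩)

/-- A ball is a disjoint union of translates of the next smaller ball. -/
theorem measure_Ball_succ [Fintype K] (ν : Measure (LaurentSeries K)) [ν.IsAddLeftInvariant]
    (n : ℤ) : ν (Ball K n) = Fintype.card K * ν (Ball K (n + 1)) := by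
  have h : (Ball K n : Set (LaurentSeries K)) =
      ⋃ a : K, (fun x => HahnSeries.single n a + x) ⁻¹' (Ball K (n + 1)) := by
    ext x
    rw [Set.mem_iUnion]
    constructor
    · intro hx
      refine ⟨-x.coeff n, fun j hj => ?_⟩
      rw [HahnSeries.coeff_add]
      rcases lt_or_eq_of_le (Int.lt_add_one_iff.1 hj) with h | rfl
      · rw [hx j h, HahnSeries.coeff_single_of_ne h.ne, add_zero]
      · rw [HahnSeries.coeff_single_same, neg_add_cancel]
    · rintro ⟨a, ha⟩
      have h2 := (Ball K n).add_mem ((Ball K n).neg_mem (single_mem_Ball le_rfl a))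
        (Ball_anti (Int.le_add_one le_rfl) ha)
      rwa [neg_add_cancel_left] at h2
  rw [h, measure_iUnion, tsum_fintype]
  · simp [measure_preimage_add]
  · intro a c hac
    refine Set.disjoint_left.2 fun x hx hy => hac ?_
    have h1 := hx n (by lia)
    have h2 := hy n (by lia)
    simp only [HahnSeries.coeff_add, HahnSeries.coeff_single_same] at h1 h2
    exact add_right_cancel (h1.trans h2.symm)
  · exact fun a => (measurableSet_Ball _).preimage (measurable_const_add _)

theorem haar_Ball [Fintype K] (n : ℤ) :
    haar K (Ball K n) = (Fintype.card K : ENNReal) ^ (-n) := by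
  have hq0 : (Fintype.card K : ENNReal) ≠ 0 := by simp
  have hqt : (Fintype.card K : ENNReal) ≠ ⊤ := ENNReal.natCast_ne_top _
  have hstep := measure_Ball_succ (haar K)
  induction n with
  | zero => simp [haar_Ball_zero]
  | succ n ih =>
    have h := hstep n
    rw [ih] at h
    rw [neg_add, ENNReal.zpow_add hq0 hqt, h, zpow_neg_one, mul_comm, ← mul_assoc,
      ENNReal.inv_mul_cancel hq0 hqt, one_mul]
  | pred n ih =>
    have h := hstep (-(n : ℤ) - 1)
    rw [sub_add_cancel, ih] at h
    rw [h, neg_sub, sub_neg_eq_add, ENNReal.zpow_add hq0 hqt, zpow_one, neg_neg]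

theorem toReal_natCast_zpow (q : ℕ) (n : ℤ) : ((q : ENNReal) ^ n).toReal = (q : ℝ) ^ n := by
  cases n <;> simp [ENNReal.toReal_inv, ENNReal.toReal_pow]

theorem haar_real_Ball [Fintype K] (n : ℤ) :
    (haar K).real (Ball K n) = (Fintype.card K : ℝ) ^ (-n) := by
  rw [measureReal_def, haar_Ball, toReal_natCast_zpow]

/-- By uniqueness of Haar measure only the constant is in question; it is read off from `F_0`, whose
preimage under `A^k` is `F_k`. -/
theorem map_dil_haar [Fintype K] (k : ℤ) :
    (haar K).map (dil k) = (Fintype.card K : ENNReal) ^ (-k) • haar K := by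
  have h1 : ((haar K).map (dil k)).IsAddHaarMeasure :=
    (dilEquiv (K := K) k).isAddHaarMeasure_map (haar K)
  have h2 : ((haar K).map (dil k)).Regular :=
    Measure.Regular.map (dilEquiv (K := K) k).toHomeomorph
  have h3 := Measure.isAddLeftInvariant_eq_smul_of_regular ((haar K).map (dil k)) (haar K)
  have h4 := congrArg (fun ν : Measure (LaurentSeries K) => ν (Ball K 0)) h3
  simp only [Measure.smul_apply, haar_Ball_zero] at h4
  rw [Measure.map_apply (continuous_dil k).measurable (measurableSet_Ball 0)] at h4
  have h5 : dil k ⁻¹' (Ball K 0 : Set (LaurentSeries K)) = (Ball K k : Set (LaurentSeries K)) := by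
    ext x
    rw [Set.mem_preimage, SetLike.mem_coe, SetLike.mem_coe, dil_mem_Ball, zero_add]
  rw [h5, haar_Ball] at h4
  rw [h4, ENNReal.smul_def, smul_eq_mul, mul_one]
  exact h3

theorem integral_comp_dil [Fintype K] (k : ℤ) (f : LaurentSeries K → ℂ) :
    ∫ x, f (dil k x) ∂(haar K) = (Fintype.card K : ℂ) ^ (-k) * ∫ x, f x ∂(haar K) := by
  have h := (dilEquiv (K := K) k).toHomeomorph.measurableEmbedding.integral_map
    (μ := haar K) f
  have h2 : ∫ y, f y ∂((haar K).map (dil k)) = ∫ x, f (dil k x) ∂(haar K) := h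
  rw [← h2, map_dil_haar, integral_smul_measure, toReal_natCast_zpow,
    Complex.real_smul]
  push_cast
  rfl

/-- A finite translation invariant measure vanishes. -/
theorem eq_zero_of_isAddLeftInvariant [Fintype K] (ν : Measure (LaurentSeries K))
    [ν.IsAddLeftInvariant] [IsFiniteMeasure ν] : ν = 0 := by
  have hq : (2 : ENNReal) ≤ Fintype.card K := by
    exact_mod_cast Fintype.one_lt_card (α := K)
  -- `F_{n-m}` consists of at least `2^m` disjoint translates of `F_n`, so positive mass on one ball
  -- would make the total mass infinite.
  have h1 : ∀ (n : ℤ) (m : ℕ), 2 ^ m * ν (Ball K n) ≤ ν Set.univ := by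
    intro n m
    induction m generalizing n with
    | zero => simpa using measure_mono (Set.subset_univ _)
    | succ m ih =>
      refine le_trans ?_ (ih (n - 1))
      rw [measure_Ball_succ ν (n - 1), sub_add_cancel, pow_succ, mul_assoc]
      gcongr
  have h2 : ∀ n : ℤ, ν (Ball K n) = 0 := by
    intro n
    by_contra h0
    have hlim : Filter.Tendsto (fun m : ℕ => (2 : ENNReal) ^ m * ν (Ball K n)) Filter.atTop
        (𝓝 (⊤ * ν (Ball K n))) :=
      ENNReal.Tendsto.mul_const (ENNReal.tendsto_pow_atTop_nhds_top_iff.2 (by norm_num))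
        (Or.inl (by simp))
    rw [ENNReal.top_mul h0] at hlim
    have := le_of_tendsto' hlim (h1 n)
    exact (measure_lt_top ν Set.univ).ne (top_le_iff.1 this)
  rw [← Measure.measure_univ_eq_zero, ← iUnion_Ball, measure_iUnion_null_iff]
  exact fun n => h2 _

end Topology

/-! ### Step functions -/

section StepFun

variable {K : Type*} [Field K]

theorem continuous_of_stepFun {M n : ℤ} {f : LaurentSeries K → ℂ} (hf : f ∈ stepFun M n) :
    Continuous f := by
  rw [continuous_iff_continuousAt]
  intro x U hU
  have h1 : (fun y => y - x) ⁻¹' (Ball K M : Set (LaurentSeries K)) ∈ 𝓝 x :=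
    (continuous_id.sub continuous_const).continuousAt (by simpa using Ball_mem_nhds M)
  refine Filter.mem_map.2 (Filter.mem_of_superset h1 fun y hy => ?_)
  have h2 := hf.1 x (y - x) hy
  rw [add_sub_cancel] at h2
  rw [Set.mem_preimage, h2]
  exact mem_of_mem_nhds hU

theorem hasCompactSupport_of_stepFun [Finite K] {M n : ℤ} {f : LaurentSeries K → ℂ} (hf : f ∈ stepFun M n) :
    HasCompactSupport f :=
  HasCompactSupport.intro (isCompact_Ball n) fun x hx => by
    by_contra h
    exact hx (hf.2 x h)

theorem memLp_of_stepFun [Finite K] {M n : ℤ} {f : LaurentSeries K → ℂ} (hf : f ∈ stepFun M n)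
    (r : ENNReal) : MemLp f r (haar K) :=
  (continuous_of_stepFun hf).memLp_of_hasCompactSupport (hasCompactSupport_of_stepFun hf)

theorem stepFun_comp_sub {M n : ℤ} {f : LaurentSeries K → ℂ} (hf : f ∈ stepFun M n)
    {h : LaurentSeries K} {m : ℤ} (hm : m ≤ n) (hh : h ∈ Ball K m) :
    (fun x => f (x - h)) ∈ stepFun M m := by
  refine ⟨fun x y hy => ?_, fun x hx => ?_⟩
  · simp only
    rw [add_sub_right_comm]
    exact hf.1 _ _ hy
  · have := (Ball K m).add_mem (Ball_anti hm (hf.2 _ hx)) hh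
    rwa [sub_add_cancel] at this

theorem memLp_comp_sub [Finite K] {M n : ℤ} {f : LaurentSeries K → ℂ} (hf : f ∈ stepFun M n)
    (h : LaurentSeries K) (r : ENNReal) : MemLp (fun x => f (x - h)) r (haar K) := by
  obtain ⟨m, hm⟩ := exists_mem_Ball h
  exact memLp_of_stepFun (stepFun_comp_sub hf (m := min n (-(m : ℤ))) (min_le_left _ _)
    (Ball_anti (min_le_right _ _) hm)) r

theorem stepFun_comp_dil {M n : ℤ} {f : LaurentSeries K → ℂ} (hf : f ∈ stepFun M n) (k : ℤ) :
    (fun x => f (dil k x)) ∈ stepFun (M + k) (n + k) := by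
  refine ⟨fun x y hy => ?_, fun x hx => ?_⟩
  · simp only
    rw [dil_add]
    exact hf.1 _ _ (dil_mem_Ball.2 hy)
  · exact dil_mem_Ball.1 (hf.2 _ hx)

theorem stepFun_mono {M n M' n' : ℤ} (hM : M ≤ M') (hn : n' ≤ n) {f : LaurentSeries K → ℂ}
    (hf : f ∈ stepFun M n) : f ∈ stepFun M' n' :=
  ⟨fun x y hy => hf.1 x y (Ball_anti hM hy), fun x hx => Ball_anti hn (hf.2 x hx)⟩

end StepFun

/-! ### The Fourier transform of step functions -/

section EvalChar

variable {K : Type*} [Field K]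

theorem ev_add (χ : Characters K) (x y : LaurentSeries K) : ev χ (x + y) = ev χ x * ev χ y := by
  rw [ev, AddChar.map_add_eq_mul, Circle.coe_mul, ev, ev]

theorem ev_zero (χ : Characters K) : ev χ 0 = 1 := by
  rw [ev, AddChar.map_zero_eq_one, Circle.coe_one]

theorem ev_neg (χ : Characters K) (x : LaurentSeries K) : ev χ (-x) = conj (ev χ x) := by
  rw [ev, AddChar.map_neg_eq_inv, Circle.coe_inv_eq_conj, ev]

theorem ev_sub (χ : Characters K) (x y : LaurentSeries K) :
    ev χ (x - y) = ev χ x * conj (ev χ y) := by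
  rw [sub_eq_add_neg, ev_add, ev_neg]

theorem ev_mul (χ ψ : Characters K) (x : LaurentSeries K) : ev (χ * ψ) x = ev χ x * ev ψ x :=
  Circle.coe_mul _ _

theorem ev_inv (χ : Characters K) (x : LaurentSeries K) : ev χ⁻¹ x = conj (ev χ x) :=
  ev_neg χ x

theorem ev_dilChar (χ : Characters K) (k : ℤ) (x : LaurentSeries K) :
    ev (dilChar χ k) x = ev χ (dil k x) := rfl

theorem continuous_ev (χ : Characters K) : Continuous (ev χ) :=
  continuous_subtype_val.comp χ.2

theorem ev_of_mem_annihilator {χ : Characters K} {H : AddSubgroup (LaurentSeries K)}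
    (hχ : χ ∈ annihilator H) {x : LaurentSeries K} (hx : x ∈ H) : ev χ x = 1 := by
  rw [ev, hχ x hx, Circle.coe_one]

open Classical in
theorem integral_ev [Fintype K] (χ : Characters K) (n : ℤ) :
    ∫ x in (Ball K n : Set (LaurentSeries K)), ev χ x ∂(haar K) =
      if χ ∈ annihilator (Ball K n) then (Fintype.card K : ℂ) ^ (-n) else 0 := by
  split_ifs with h
  · rw [setIntegral_congr_fun (measurableSet_Ball n) (g := fun _ => (1 : ℂ)) fun x hx =>
      ev_of_mem_annihilator h hx, setIntegral_const, haar_real_Ball, Complex.real_smul, mul_one]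
    push_cast
    rfl
  · have h' : ∃ y ∈ Ball K n, (χ : AddChar (LaurentSeries K) Circle) y ≠ 1 := by
      by_contra h'
      push Not at h'
      exact h h'
    obtain ⟨y, hy, hy1⟩ := h'
    rw [← integral_indicator (measurableSet_Ball n)]
    set I := ∫ x, (Ball K n : Set (LaurentSeries K)).indicator (ev χ) x ∂(haar K) with hI
    -- Translation by `y ∈ F_n` preserves the ball and multiplies the integral by `χ(y) ≠ 1`.
    have h1 : I = ev χ y * I := by
      conv_lhs => rw [hI, ← integral_add_right_eq_self _ y]
      rw [hI, ← integral_const_mul]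
      congr 1
      funext x
      by_cases hx : x ∈ Ball K n
      · rw [Set.indicator_of_mem (show x + y ∈ (Ball K n : Set _) from (Ball K n).add_mem hx hy),
          Set.indicator_of_mem (show x ∈ (Ball K n : Set _) from hx), ev_add, mul_comm]
      · have hxy : x + y ∉ Ball K n := fun h => hx (by
          have := (Ball K n).sub_mem h hy
          rwa [add_sub_cancel_right] at this)
        rw [Set.indicator_of_notMem (show x + y ∉ (Ball K n : Set _) from hxy),
          Set.indicator_of_notMem (show x ∉ (Ball K n : Set _) from hx), mul_zero]
    have h2 : ev χ y ≠ 1 := fun h => hy1 (Circle.coe_injective (by simpa [ev] using h))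
    have h3 : (1 - ev χ y) * I = 0 := by
      rw [sub_mul, one_mul, ← h1, sub_self]
    exact (mul_eq_zero.1 h3).resolve_left (sub_ne_zero.2 h2.symm)

theorem integrable_stepFun_mul [Finite K] {M n : ℤ} {f : LaurentSeries K → ℂ}
    (hf : f ∈ stepFun M n) {g : LaurentSeries K → ℂ} (hg : Continuous g) :
    Integrable (fun x => f x * g x) (haar K) :=
  ((continuous_of_stepFun hf).mul hg).integrable_of_hasCompactSupport
    (hasCompactSupport_of_stepFun hf).mul_right

theorem fourier_comp_sub [Finite K] (f : LaurentSeries K → ℂ) (h : LaurentSeries K)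
    (χ : Characters K) : fourier (fun x => f (x - h)) χ = conj (ev χ h) * fourier f χ := by
  rw [fourier, ← integral_add_right_eq_self _ h, fourier, ← integral_const_mul]
  congr 1
  funext x
  rw [add_sub_cancel_right, ev_add, map_mul]
  ring

theorem fourier_comp_dil [Fintype K] (f : LaurentSeries K → ℂ) (k : ℤ) (χ : Characters K) :
    fourier (fun x => f (dil k x)) χ =
      (Fintype.card K : ℂ) ^ (-k) * fourier f (dilChar χ (-k)) := by
  rw [fourier, fourier, ← integral_comp_dil k]
  congr 1
  funext x
  rw [ev_dilChar, dil_dil, neg_add_cancel, dil_zero]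

theorem ev_mkChar {p s : ℕ} [Fact p.Prime] [Algebra (ZMod p) K]
    (b : Module.Basis (Fin s) (ZMod p) K) (n : ℤ) {L : ℕ} (c : Fin L → K) (x : LaurentSeries K) :
    ev (mkChar b n c) x = ∏ i : Fin L, (pairing b (c i) (x.coeff (n + (i : ℤ))) : ℂ) := by
  rw [ev, apply_mkChar]
  exact map_prod Circle.coeHom _ _

end EvalChar

/-! ### Inversion and Plancherel for step functions. -/

section Synthesis

variable {p s : ℕ} [Fact p.Prime] {K : Type*} [Field K] [Fintype K] [Algebra (ZMod p) K]
  (b : Module.Basis (Fin s) (ZMod p) K)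

theorem ev_finSeries (χ : Characters K) (n : ℤ) {L : ℕ} (c : Fin L → K) :
    ev χ (finSeries n c) = ∏ i : Fin L, (pairing b (digit b χ (n + i)) (c i) : ℂ) := by
  rw [ev, apply_finSeries b]
  exact map_prod Circle.coeHom _ _

-- The characters `mkChar b n c` represent `F_{n+L}^⊥ / F_n^⊥`, the dual of `F_n / F_{n+L}`; this is
-- the orthogonality relation on that finite group.
open Classical in
theorem sum_ev_mkChar (n : ℤ) (L : ℕ) {x : LaurentSeries K} (hx : x ∈ Ball K n) :
    ∑ c : Fin L → K, ev (mkChar b n c) x =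
      if x ∈ Ball K (n + L) then (Fintype.card K : ℂ) ^ L else 0 := by
  have h1 : (fun i : Fin L => x.coeff (n + (i : ℤ))) = 0 ↔ x ∈ Ball K (n + L) := by
    constructor
    · intro h j hj
      rcases lt_or_ge j n with hlt | hge
      · exact hx j hlt
      · have := congrFun h ⟨(j - n).toNat, by lia⟩
        simp only [Pi.zero_apply] at this
        convert this using 2
        lia
    · intro h
      funext i
      have := i.2
      exact h _ (by lia)
  simp only [ev_mkChar, pairing_comm b _ (x.coeff _)]
  rw [sum_prod_pairing b, Fintype.card_fin]
  simp only [h1]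

/-- The inverse Fourier transform of a function on the characters which is constant on the cosets
of the annihilator of `Ball K n` and supported in the annihilator of `Ball K (n + L)`. -/
def synthesis (n : ℤ) (L : ℕ) (Φ : Characters K → ℂ) : LaurentSeries K → ℂ :=
  (Ball K n : Set (LaurentSeries K)).indicator fun x =>
    -- The factor `q^n`, with `q` the order of `K`, is the inverse of the measure of `F_n`.
    (Fintype.card K : ℂ) ^ n * ∑ c : Fin L → K, Φ (mkChar b n c) * ev (mkChar b n c) x

theorem synthesis_mem_stepFun {n M : ℤ} (L : ℕ) {Φ : Characters K → ℂ} (hM : n ≤ M)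
    (hΦ : ∀ χ, Φ χ ≠ 0 → χ ∈ annihilator (Ball K M)) : synthesis b n L Φ ∈ stepFun M n := by
  refine ⟨fun x y hy => ?_, fun x hx => Set.mem_of_indicator_ne_zero hx⟩
  have hyn := Ball_anti hM hy
  by_cases hx : x ∈ Ball K n
  · rw [synthesis,
      Set.indicator_of_mem (show x + y ∈ (Ball K n : Set _) from (Ball K n).add_mem hx hyn),
      Set.indicator_of_mem (show x ∈ (Ball K n : Set _) from hx)]
    congr 1
    refine Finset.sum_congr rfl fun c _ => ?_
    by_cases h0 : Φ (mkChar b n c) = 0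
    · rw [h0, zero_mul, zero_mul]
    · rw [ev_add, ev_of_mem_annihilator (hΦ _ h0) hy, mul_one]
  · have hxy : x + y ∉ Ball K n := fun h => hx (by
      have := (Ball K n).sub_mem h hyn
      rwa [add_sub_cancel_right] at this)
    rw [synthesis, Set.indicator_of_notMem (show x + y ∉ (Ball K n : Set _) from hxy),
      Set.indicator_of_notMem (show x ∉ (Ball K n : Set _) from hx)]

/-- Integration over `F_n` keeps the term `c` only if `mkChar b n c` and `χ` agree modulo `F_n^⊥`.
One such `c` exists if `χ ∈ F_{n+L}^⊥`, and none otherwise, when `Φ χ` is zero as well. -/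
theorem fourier_synthesis {n M : ℤ} {L : ℕ} {Φ : Characters K → ℂ} (hML : M ≤ n + L)
    (hΦ : Φ ∈ dualStepFun n M) (χ : Characters K) : fourier (synthesis b n L Φ) χ = Φ χ := by
  classical
  have hq : (Fintype.card K : ℂ) ≠ 0 := by simp
  have h1 : fourier (synthesis b n L Φ) χ = ∫ x in (Ball K n : Set (LaurentSeries K)),
      ∑ c : Fin L → K, (Fintype.card K : ℂ) ^ n * Φ (mkChar b n c) *
        ev (mkChar b n c * χ⁻¹) x ∂(haar K) := by
    rw [fourier, ← integral_indicator (measurableSet_Ball n)]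
    congr 1
    funext x
    by_cases hx : x ∈ (Ball K n : Set (LaurentSeries K))
    · rw [synthesis, Set.indicator_of_mem hx, Set.indicator_of_mem hx, Finset.mul_sum,
        Finset.sum_mul]
      refine Finset.sum_congr rfl fun c _ => ?_
      rw [ev_mul, ev_inv]
      ring
    · rw [synthesis, Set.indicator_of_notMem hx, Set.indicator_of_notMem hx, zero_mul]
  have h2 : ∀ ψ : Characters K, IntegrableOn (ev ψ) (Ball K n : Set (LaurentSeries K)) (haar K) :=
    fun ψ => (continuous_ev ψ).continuousOn.integrableOn_compact (isCompact_Ball n)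
  rw [h1, integral_finsetSum _ fun c _ => (h2 _).const_mul _]
  simp only [integral_const_mul, integral_ev]
  have h3 : ∀ c : Fin L → K, mkChar b n c * χ⁻¹ ∈ annihilator (Ball K n) ↔
      ∀ k, n ≤ k → digit b (mkChar b n c) k = digit b χ k := by
    intro c
    rw [mem_annihilator_iff b]
    simp only [digit_mul, digit_inv, add_neg_eq_zero]
  by_cases hχ : χ ∈ annihilator (Ball K (n + L))
  · rw [Finset.sum_eq_single fun i : Fin L => digit b χ (n + i)]
    · have h4 : mkChar b n (fun i : Fin L => digit b χ (n + i)) * χ⁻¹ ∈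
          annihilator (Ball K n) := by
        rw [h3]
        intro k hk
        rcases lt_or_ge k (n + L) with hlt | hge
        · obtain ⟨i, rfl⟩ : ∃ i : Fin L, k = n + i := ⟨⟨(k - n).toNat, by lia⟩, by simp only; lia⟩
          rw [digit_mkChar]
        · rw [digit_mkChar_of_le _ _ _ hge, (mem_annihilator_iff b).1 hχ k hge]
      have h5 := hΦ.1 χ _ h4
      rw [mul_comm χ, inv_mul_cancel_right] at h5
      rw [if_pos h4, h5, mul_right_comm, ← zpow_add₀ hq, add_neg_cancel, zpow_zero, one_mul]
    · intro c _ hc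
      rw [if_neg, mul_zero]
      rw [h3]
      intro h
      refine hc (funext fun i => ?_)
      rw [← h _ (by lia), digit_mkChar]
    · simp
  · rw [Finset.sum_eq_zero]
    · symm
      by_contra h
      exact hχ fun x hx => hΦ.2 χ h x (Ball_anti hML hx)
    · intro c _
      rw [if_neg, mul_zero]
      rw [h3]
      intro h
      refine hχ ((mem_annihilator_iff b).2 fun k hk => ?_)
      rw [← h k (by lia), digit_mkChar_of_le _ _ _ hk]

/-- Fourier inversion for step functions. -/
theorem synthesis_fourier {n : ℤ} {L : ℕ} {f : LaurentSeries K → ℂ} (hf : f ∈ stepFun (n + L) n) :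
    synthesis b n L (fourier f) = f := by
  classical
  have hq : (Fintype.card K : ℂ) ≠ 0 := by simp
  funext x
  by_cases hx : x ∈ Ball K n
  · rw [synthesis, Set.indicator_of_mem (show x ∈ (Ball K n : Set _) from hx)]
    have h1 : ∀ c : Fin L → K, fourier f (mkChar b n c) * ev (mkChar b n c) x =
        ∫ y, f y * ev (mkChar b n c) (x - y) ∂(haar K) := by
      intro c
      rw [fourier, ← integral_mul_const]
      congr 1
      funext y
      rw [ev_sub]
      ring
    simp only [h1]
    have hint : ∀ c : Fin L → K,
        Integrable (fun y => f y * ev (mkChar b n c) (x - y)) (haar K) := fun c =>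
      integrable_stepFun_mul hf ((continuous_ev _).comp (continuous_const.sub continuous_id))
    rw [← integral_finsetSum _ fun c _ => hint c]
    -- The characters sum to the kernel `q^L 1_{F_{n+L}}(x - y)`, which averages `f` over a coset on
    -- which it is constant.
    have h2 : ∀ y, ∑ c : Fin L → K, f y * ev (mkChar b n c) (x - y) =
        ((fun y => -x + y) ⁻¹' (Ball K (n + L) : Set (LaurentSeries K))).indicator
          (fun _ => (Fintype.card K : ℂ) ^ L * f x) y := by
      intro y
      have hiff : x - y ∈ Ball K (n + L) ↔
          y ∈ (fun y => -x + y) ⁻¹' (Ball K (n + L) : Set (LaurentSeries K)) := by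
        rw [← neg_mem_iff, neg_sub, sub_eq_neg_add]
        rfl
      rw [← Finset.mul_sum]
      by_cases hy : y ∈ Ball K n
      · rw [sum_ev_mkChar b n L ((Ball K n).sub_mem hx hy)]
        split_ifs with h
        · rw [Set.indicator_of_mem (hiff.1 h), mul_comm]
          have := hf.1 y _ h
          rw [add_sub_cancel] at this
          rw [this]
        · rw [Set.indicator_of_notMem (fun h' => h (hiff.2 h')), mul_zero]
      · have h0 : f y = 0 := by
          by_contra h
          exact hy (hf.2 y h)
        rw [h0, zero_mul, Set.indicator_of_notMem]
        intro h'
        refine hy ?_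
        have := (Ball K n).sub_mem hx (Ball_anti (by lia) (hiff.2 h'))
        rwa [sub_sub_cancel] at this
    simp only [h2]
    rw [integral_indicator ((measurableSet_Ball _).preimage (measurable_const_add _)),
      setIntegral_const, measureReal_def, measure_preimage_add, ← measureReal_def, haar_real_Ball,
      Complex.real_smul]
    push_cast
    rw [← mul_assoc, ← mul_assoc, ← zpow_natCast, ← zpow_add₀ hq, ← zpow_add₀ hq,
      show n + -(n + (L : ℤ)) + L = 0 by ring, zpow_zero, one_mul]
  · rw [synthesis, Set.indicator_of_notMem (show x ∉ (Ball K n : Set _) from hx)]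
    by_contra h
    exact hx (hf.2 x (Ne.symm h))

/-- Inner products of translates, computed on the Fourier side. -/
theorem integral_conj_synthesis {n M : ℤ} {L : ℕ} {Φ : Characters K → ℂ} (hnM : n ≤ M)
    (hML : M ≤ n + L) (hΦ : Φ ∈ dualStepFun n M) {δ : LaurentSeries K} (hδ : δ ∈ Ball K n) :
    ∫ x, conj (synthesis b n L Φ x) * synthesis b n L Φ (x - δ) ∂(haar K) =
      (Fintype.card K : ℂ) ^ n * ∑ c : Fin L → K,
        ((‖Φ (mkChar b n c)‖ ^ 2 : ℝ) : ℂ) * conj (ev (mkChar b n c) δ) := by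
  have hf := synthesis_mem_stepFun b L hnM hΦ.2
  -- Only the translated factor is expanded; the remaining integrals are conjugates of values of the
  -- Fourier transform of the other factor.
  have h1 : ∀ x, conj (synthesis b n L Φ x) * synthesis b n L Φ (x - δ) =
      ∑ c : Fin L → K, (Fintype.card K : ℂ) ^ n * Φ (mkChar b n c) * conj (ev (mkChar b n c) δ) *
        conj (synthesis b n L Φ x * conj (ev (mkChar b n c) x)) := by
    intro x
    by_cases hx : x ∈ Ball K n
    · have h2 : synthesis b n L Φ (x - δ) = (Fintype.card K : ℂ) ^ n *
          ∑ c : Fin L → K, Φ (mkChar b n c) * ev (mkChar b n c) (x - δ) :=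
        Set.indicator_of_mem (show x - δ ∈ (Ball K n : Set _) from (Ball K n).sub_mem hx hδ) _
      rw [h2, Finset.mul_sum, Finset.mul_sum]
      refine Finset.sum_congr rfl fun c _ => ?_
      rw [ev_sub, map_mul, Complex.conj_conj]
      ring
    · have h0 : synthesis b n L Φ x = 0 :=
        Set.indicator_of_notMem (show x ∉ (Ball K n : Set _) from hx) _
      simp [h0]
  simp only [h1]
  rw [integral_finsetSum _ fun c _ => ?_, Finset.mul_sum]
  · refine Finset.sum_congr rfl fun c _ => ?_
    rw [integral_const_mul, integral_conj]
    have h3 := fourier_synthesis b hML hΦ (mkChar b n c)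
    rw [fourier] at h3
    rw [h3]
    push_cast
    rw [← Complex.conj_mul']
    ring
  · refine Integrable.const_mul ?_ _
    have := integrable_stepFun_mul hf
      (Complex.continuous_conj.comp (continuous_ev (mkChar b n c)))
    exact Complex.conjLIE.toContinuousLinearEquiv.toContinuousLinearMap.integrable_comp this

end Synthesis

/-! ### The scaling function -/

section Scaling

variable {p s : ℕ} [Fact p.Prime] {K : Type*} [Field K] [Fintype K] [Algebra (ZMod p) K]
  {b : Module.Basis (Fin s) (ZMod p) K} {N : ℕ} {m₀ : Characters K → ℂ}
  {V : Type*} {T : RTree V} {lab : V → K} {hT : T.NValid lab N}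

/-- The inverse Fourier transform of the infinite product. -/
def scalingFun (b : Module.Basis (Fin s) (ZMod p) K) (N H : ℕ) (m₀ : Characters K → ℂ) :
    LaurentSeries K → ℂ :=
  synthesis b (-(N : ℤ)) (N + H) (maskProduct m₀)

theorem IsAdapted.scalingFun_mem_stepFun (hN : 1 ≤ N)
    (hm₀ : IsAdapted b (arrayDigraph hT.derivedTree) m₀) (h : IsMask N m₀) :
    scalingFun b N hT.derivedTree.height m₀ ∈
      stepFun (K := K) ((hT.derivedTree.height : ℤ) - N) (-(N : ℤ)) :=
  synthesis_mem_stepFun b _ (by lia) (hm₀.maskProduct_mem_dualStepFun hN h).2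

theorem IsAdapted.fourier_scalingFun (hN : 1 ≤ N)
    (hm₀ : IsAdapted b (arrayDigraph hT.derivedTree) m₀) (h : IsMask N m₀) (χ : Characters K) :
    fourier (scalingFun b N hT.derivedTree.height m₀) χ = maskProduct m₀ χ :=
  fourier_synthesis b (by push_cast; lia) (hm₀.maskProduct_mem_dualStepFun hN h) χ

theorem window_zero_eq_restrict (N : ℕ) {L : ℕ} (c : Fin (N + L) → K) :
    window b N (mkChar b (-(N : ℤ)) c) 0 = fun i => c (Fin.castAdd L i) := by
  funext i
  rw [window, Nat.cast_zero, zero_sub]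
  exact digit_mkChar b _ c (Fin.castAdd L i)

/-- The translates of the scaling function by shifts in its support add up to one. -/
theorem IsAdapted.sum_scalingFun_add (hm₀ : IsAdapted b (arrayDigraph hT.derivedTree) m₀)
    (h : IsMask N m₀) (H : ℕ) (x : LaurentSeries K) :
    ∑ a : Fin N → K, scalingFun b N H m₀ (x + finSeries (-(N : ℤ)) a) =
      (Ball K (-(N : ℤ)) : Set (LaurentSeries K)).indicator (fun _ => (1 : ℂ)) x := by
  classical
  have hq : (Fintype.card K : ℂ) ≠ 0 := by simp
  by_cases hx : x ∈ Ball K (-(N : ℤ))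
  · rw [Set.indicator_of_mem (show x ∈ (Ball K (-(N : ℤ)) : Set _) from hx)]
    have h1 : ∀ a : Fin N → K, scalingFun b N H m₀ (x + finSeries (-(N : ℤ)) a) =
        (Fintype.card K : ℂ) ^ (-(N : ℤ)) * ∑ c : Fin (N + H) → K,
          maskProduct m₀ (mkChar b (-(N : ℤ)) c) * ev (mkChar b (-(N : ℤ)) c) x *
            ∏ i, (pairing b (window b N (mkChar b (-(N : ℤ)) c) 0 i) (a i) : ℂ) := by
      intro a
      rw [scalingFun, synthesis, Set.indicator_of_mem
        (show x + finSeries (-(N : ℤ)) a ∈ (Ball K (-(N : ℤ)) : Set _) from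
          (Ball K _).add_mem hx (finSeries_mem_Ball _ a))]
      congr 1
      refine Finset.sum_congr rfl fun c _ => ?_
      rw [ev_add, ev_finSeries b, ← mul_assoc]
      simp only [window, Nat.cast_zero, zero_sub]
    simp only [h1]
    rw [← Finset.mul_sum, Finset.sum_comm]
    simp only [← Finset.mul_sum, sum_prod_pairing, Fintype.card_fin]
    -- The sum over `a` removes every `c` with nonzero initial window; if that window is zero and `c
    -- ≠ 0`, the mask product vanishes.
    rw [Finset.sum_eq_single 0]
    · have h0 : ∀ j, digit b (mkChar b (-(N : ℤ)) (0 : Fin (N + H) → K)) j = 0 := by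
        intro j
        rw [mkChar, digit_prod]
        exact Finset.sum_eq_zero fun i _ => by rw [digit_rad]; split_ifs <;> rfl
      rw [hm₀.maskProduct_of_digit_zero fun j _ => h0 j, window_zero_eq_restrict,
        if_pos (by rfl), ev_mkChar]
      simp only [Pi.zero_apply, pairing_zero_left, Circle.coe_one, Finset.prod_const_one, mul_one,
        one_mul]
      rw [← zpow_natCast, ← zpow_add₀ hq, neg_add_cancel, zpow_zero]
    · intro c _ hc
      split_ifs with hw
      · obtain ⟨i, hi⟩ := Function.ne_iff.1 hc
        rw [hm₀.maskProduct_of_window_zero h hw ⟨-(N : ℤ) + i, by lia, by rwa [digit_mkChar]⟩,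
          zero_mul, zero_mul]
      · rw [mul_zero]
    · simp
  · rw [Set.indicator_of_notMem (show x ∉ (Ball K (-(N : ℤ)) : Set _) from hx)]
    refine Finset.sum_eq_zero fun a _ => ?_
    by_contra hne
    rw [scalingFun, synthesis] at hne
    have ha : x + finSeries (-(N : ℤ)) a ∈ Ball K (-(N : ℤ)) := Set.mem_of_indicator_ne_zero hne
    refine hx ?_
    have := (Ball K (-(N : ℤ))).sub_mem ha (finSeries_mem_Ball _ a)
    rwa [add_sub_cancel_right] at this

/-- The shifts of the scaling function are orthonormal. -/
theorem IsAdapted.integral_conj_scalingFun (hN : 1 ≤ N)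
    (hm₀ : IsAdapted b (arrayDigraph hT.derivedTree) m₀) (h : IsMask N m₀)
    {δ : LaurentSeries K} (hδ : δ ∈ shifts K) [Decidable (δ = 0)] :
    ∫ x, conj (scalingFun b N hT.derivedTree.height m₀ x) *
      scalingFun b N hT.derivedTree.height m₀ (x - δ) ∂(haar K) = if δ = 0 then 1 else 0 := by
  classical
  set H := hT.derivedTree.height with hH
  have hq : (Fintype.card K : ℂ) ≠ 0 := by simp
  -- If `δ ∉ F_{-N}`, the supports of `φ` and of its translate are disjoint, so only the first case
  -- needs Fourier analysis.
  by_cases hδN : δ ∈ Ball K (-(N : ℤ))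
  · have hmem := hm₀.maskProduct_mem_dualStepFun hN h
    rw [scalingFun, integral_conj_synthesis b (by lia) (by push_cast; lia) hmem hδN]
    have h1 : ∀ c : Fin (N + H) → K, ‖maskProduct m₀ (mkChar b (-(N : ℤ)) c)‖ ^ 2 =
        ∏ k ∈ Finset.range H, ‖m₀ (dilChar (mkChar b (-(N : ℤ)) c) (-(k : ℤ)))‖ ^ 2 := by
      intro c
      rw [hm₀.maskProduct_eq_prod_height h fun j hj =>
        digit_mkChar_of_le b _ c (by push_cast; lia), norm_prod, Finset.prod_pow]
    -- A shift has no coefficients of nonnegative index, so its pairing with the character depends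
    -- on the initial window only.
    have h2 : ∀ c : Fin (N + H) → K, conj (ev (mkChar b (-(N : ℤ)) c) δ) =
        ∏ i : Fin N, (pairing b (-δ.coeff (-(N : ℤ) + i))
          (window b N (mkChar b (-(N : ℤ)) c) 0 i) : ℂ) := by
      intro c
      rw [← ev_neg, ev_mkChar, Fin.prod_univ_add, window_zero_eq_restrict]
      rw [Finset.prod_eq_one (s := (Finset.univ : Finset (Fin H))), mul_one]
      · refine Finset.prod_congr rfl fun i _ => ?_
        rw [pairing_comm, HahnSeries.coeff_neg]
        rfl
      · intro i _
        rw [HahnSeries.coeff_neg, hδ _ (by simp), neg_zero, AddChar.map_zero_eq_one,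
          Circle.coe_one]
    simp only [h1, h2]
    rw [hm₀.sum_prod_norm_sq h (fun A => ∏ i : Fin N,
      (pairing b (-δ.coeff (-(N : ℤ) + i)) (A i) : ℂ)) H, sum_prod_pairing, Fintype.card_fin]
    have h3 : (fun i : Fin N => -δ.coeff (-(N : ℤ) + i)) = 0 ↔ δ = 0 := by
      constructor
      · intro h0
        ext j
        rcases lt_or_ge j (-(N : ℤ)) with hlt | hge
        · exact hδN j hlt
        · rcases lt_or_ge j 0 with hlt' | hge'
          · have := congrFun h0 ⟨(j + N).toNat, by lia⟩
            rw [Pi.zero_apply, neg_eq_zero] at this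
            rw [HahnSeries.coeff_zero, ← this]
            congr 1
            simp only
            lia
          · exact hδ j hge'
      · rintro rfl
        funext i
        simp
    simp only [h3]
    split_ifs
    · rw [← zpow_natCast, ← zpow_add₀ hq, neg_add_cancel, zpow_zero]
    · rw [mul_zero]
  · have h0 : δ ≠ 0 := by
      rintro rfl
      exact hδN (zero_mem _)
    rw [if_neg h0, integral_eq_zero_of_ae]
    refine Filter.Eventually.of_forall fun x => ?_
    have hstep := hm₀.scalingFun_mem_stepFun hN h
    by_contra hne
    have h1 := left_ne_zero_of_mul hne
    have h2 := right_ne_zero_of_mul hne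
    have h3 := (Ball K (-(N : ℤ))).sub_mem (hstep.2 x fun h => h1 (by rw [h, map_zero]))
      (hstep.2 _ h2)
    rw [sub_sub_cancel] at h3
    exact hδN h3

/-- The refinement equation. -/
theorem IsAdapted.exists_refinement (hN : 1 ≤ N)
    (hm₀ : IsAdapted b (arrayDigraph hT.derivedTree) m₀) (h : IsMask N m₀) :
    ∃ β : (Fin (N + 1) → K) → ℂ, ∀ x, scalingFun b N hT.derivedTree.height m₀ x =
      ∑ c, β c * scalingFun b N hT.derivedTree.height m₀ (dil 1 x - shiftElt c) := by
  have hstep := hm₀.scalingFun_mem_stepFun hN h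
  have hfour := hm₀.fourier_scalingFun hN h
  have hmask := h
  obtain ⟨β, hβ⟩ := h
  set H := hT.derivedTree.height with hH
  set φ := scalingFun b N H m₀ with hφ
  refine ⟨β, fun x => sub_eq_zero.1 ?_⟩
  -- The difference of the two sides is a step function, so it is zero once its Fourier transform
  -- is. There the dilation contributes `q⁻¹` and the translation a conjugated value of `χA^{-1}`,
  -- which together rebuild `m₀(χ)`.
  let f : LaurentSeries K → ℂ := fun x => φ x - ∑ c, β c * φ (dil 1 x - shiftElt c)
  have hterm : ∀ c : Fin (N + 1) → K,
      (fun x => φ (dil 1 x - shiftElt c)) ∈ stepFun (K := K) ((H : ℤ) - N + 1) (-(N : ℤ)) := by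
    intro c
    have h1 := stepFun_comp_sub hstep (m := -(N + 1 : ℕ)) (by push_cast; lia)
      (shiftElt_mem_Ball c)
    exact stepFun_mono (by lia) (by push_cast; lia) (stepFun_comp_dil h1 1)
  have hf : f ∈ stepFun (K := K) (-(N : ℤ) + (N + H + 1 : ℕ)) (-(N : ℤ)) := by
    have h1 : f ∈ stepFun (K := K) ((H : ℤ) - N + 1) (-(N : ℤ)) := by
      constructor
      · intro x y hy
        have h2 := hstep.1 x y (Ball_anti (by lia) hy)
        have h3 := fun c => (hterm c).1 x y hy
        simp only at h3
        simp only [f, h2, h3]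
      · intro x hx
        by_contra hxN
        refine hx ?_
        have h2 : φ x = 0 := by
          by_contra h2
          exact hxN (hstep.2 x h2)
        have h3 : ∀ c, φ (dil 1 x - shiftElt c) = 0 := fun c => by
          by_contra h3
          exact hxN ((hterm c).2 x h3)
        simp [f, h2, h3]
    exact stepFun_mono (by push_cast; lia) le_rfl h1
  have hff : fourier f = 0 := by
    funext χ
    have hcont : Continuous fun x => conj (ev χ x) :=
      Complex.continuous_conj.comp (continuous_ev χ)
    have h1 : fourier f χ = fourier φ χ -
        ∑ c, β c * fourier (fun x => φ (dil 1 x - shiftElt c)) χ := by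
      simp only [fourier, ← integral_const_mul]
      rw [← integral_finsetSum, ← integral_sub]
      · congr 1
        funext x
        simp only [f, sub_mul, Finset.sum_mul, mul_assoc]
      · exact integrable_stepFun_mul hstep hcont
      · exact integrable_finsetSum _ fun c _ =>
          (integrable_stepFun_mul (hterm c) hcont).const_mul _
      · exact fun c _ => (integrable_stepFun_mul (hterm c) hcont).const_mul _
    rw [h1, hfour, hm₀.maskProduct_succ χ, hβ χ, Pi.zero_apply, sub_eq_zero, Finset.mul_sum,
      Finset.sum_mul]
    refine Finset.sum_congr rfl fun c _ => ?_
    rw [fourier_comp_dil (fun y => φ (y - shiftElt c)), fourier_comp_sub, hfour, zpow_neg_one]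
    ring
  have h2 := synthesis_fourier b hf
  rw [hff] at h2
  have h3 := congrFun h2 x
  show f x = 0
  rw [← h3, synthesis]
  simp

end Scaling

/-! ### Dilations and translations of `L²` -/

section CompLp

variable {α : Type*} [MeasurableSpace α] {μ : Measure α} {c : ENNReal} {S : α → α}

theorem eLpNorm_comp_of_map_eq_smul (hS : Measurable S) (hc : c ≠ 0) (hμ : μ.map S = c • μ)
    {f : α → ℂ} (hf : AEStronglyMeasurable f μ) :
    eLpNorm (f ∘ S) 2 μ = c ^ (1 / (2 : ENNReal)).toReal * eLpNorm f 2 μ := by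
  have hf' : AEStronglyMeasurable f (μ.map S) := by
    rw [hμ]
    exact hf.smul_measure c
  rw [← eLpNorm_map_measure hf' hS.aemeasurable, hμ, eLpNorm_smul_measure_of_ne_zero hc,
    smul_eq_mul]

theorem quasiMeasurePreserving_of_map_eq_smul (hS : Measurable S) (hμ : μ.map S = c • μ) :
    Measure.QuasiMeasurePreserving S μ μ :=
  ⟨hS, hμ ▸ Measure.smul_absolutelyContinuous⟩

theorem memLp_comp_of_map_eq_smul (hS : Measurable S) (hc : c ≠ 0) (hc' : c ≠ ⊤)
    (hμ : μ.map S = c • μ) {f : α → ℂ} (hf : MemLp f 2 μ) : MemLp (f ∘ S) 2 μ := by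
  refine ⟨hf.1.comp_quasiMeasurePreserving (quasiMeasurePreserving_of_map_eq_smul hS hμ), ?_⟩
  rw [eLpNorm_comp_of_map_eq_smul hS hc hμ hf.1]
  exact ENNReal.mul_lt_top (ENNReal.rpow_lt_top_of_nonneg (by positivity) hc') hf.2

/-- Composition with a map which scales the measure, as an operator of `L²`. -/
def compLp (hS : Measurable S) (hc : c ≠ 0) (hc' : c ≠ ⊤) (hμ : μ.map S = c • μ) :
    Lp ℂ 2 μ →L[ℂ] Lp ℂ 2 μ :=
  LinearMap.mkContinuous
    { toFun := fun f => (memLp_comp_of_map_eq_smul hS hc hc' hμ (Lp.memLp f)).toLp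
      map_add' := fun f g => by
        rw [← MemLp.toLp_add]
        exact MemLp.toLp_congr _ _
          ((quasiMeasurePreserving_of_map_eq_smul hS hμ).ae_eq_comp (Lp.coeFn_add f g))
      map_smul' := fun a f => by
        rw [RingHom.id_apply, ← MemLp.toLp_const_smul]
        exact MemLp.toLp_congr _ _
          ((quasiMeasurePreserving_of_map_eq_smul hS hμ).ae_eq_comp (Lp.coeFn_smul a f)) }
    (c ^ (1 / (2 : ENNReal)).toReal).toReal
    fun f => by
      show ‖(memLp_comp_of_map_eq_smul hS hc hc' hμ (Lp.memLp f)).toLp‖ ≤ _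
      rw [Lp.norm_toLp, eLpNorm_comp_of_map_eq_smul hS hc hμ (Lp.aestronglyMeasurable f),
        ENNReal.toReal_mul, Lp.norm_def]

theorem coeFn_compLp (hS : Measurable S) (hc : c ≠ 0) (hc' : c ≠ ⊤) (hμ : μ.map S = c • μ)
    (f : Lp ℂ 2 μ) : compLp hS hc hc' hμ f =ᵐ[μ] fun x => f (S x) :=
  MemLp.coeFn_toLp (memLp_comp_of_map_eq_smul hS hc hc' hμ (Lp.memLp f))

end CompLp

/-! ### The operators on `L²` of the local field. -/

section Operators

variable {K : Type*} [Field K] [Fintype K]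

theorem zpow_card_ne_zero (n : ℤ) : (Fintype.card K : ENNReal) ^ n ≠ 0 :=
  (ENNReal.zpow_pos (by simp) (ENNReal.natCast_ne_top _) n).ne'

theorem zpow_card_ne_top (n : ℤ) : (Fintype.card K : ENNReal) ^ n ≠ ⊤ :=
  (ENNReal.zpow_lt_top (by simp) (ENNReal.natCast_ne_top _) n).ne

theorem quasiMeasurePreserving_dil (k : ℤ) :
    Measure.QuasiMeasurePreserving (dil (K := K) k) (haar K) (haar K) :=
  quasiMeasurePreserving_of_map_eq_smul (continuous_dil k).measurable (map_dil_haar k)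

/-- The dilation `f ↦ f (A^k ·)` of `L²`. -/
def dilLp (k : ℤ) : Lp ℂ 2 (haar K) →L[ℂ] Lp ℂ 2 (haar K) :=
  compLp (continuous_dil k).measurable (zpow_card_ne_zero _) (zpow_card_ne_top _) (map_dil_haar k)

theorem coeFn_dilLp (k : ℤ) (f : Lp ℂ 2 (haar K)) :
    dilLp k f =ᵐ[haar K] fun x => f (dil k x) :=
  coeFn_compLp _ _ _ _ f

theorem dilLp_eq {k : ℤ} {f : Lp ℂ 2 (haar K)} {g : LaurentSeries K → ℂ} (h : f =ᵐ[haar K] g) :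
    dilLp k f =ᵐ[haar K] fun x => g (dil k x) :=
  (coeFn_dilLp k f).trans ((quasiMeasurePreserving_dil k).ae_eq_comp h)

theorem dilLp_dilLp (j k : ℤ) (f : Lp ℂ 2 (haar K)) : dilLp j (dilLp k f) = dilLp (j + k) f := by
  refine Lp.ext ((dilLp_eq (coeFn_dilLp k f)).trans ?_)
  simp only [dil_dil, add_comm k j]
  exact (coeFn_dilLp _ f).symm

theorem dilLp_zero (f : Lp ℂ 2 (haar K)) : dilLp 0 f = f := by
  refine Lp.ext ((coeFn_dilLp 0 f).trans ?_)
  simp only [dil_zero]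
  rfl

/-- The translation `f ↦ f (· + y)` of `L²`. -/
def transLp (y : LaurentSeries K) : Lp ℂ 2 (haar K) →ₗᵢ[ℂ] Lp ℂ 2 (haar K) :=
  Lp.compMeasurePreservingₗᵢ ℂ (fun x => x + y) (measurePreserving_add_right (haar K) y)

theorem coeFn_transLp (y : LaurentSeries K) (f : Lp ℂ 2 (haar K)) :
    transLp y f =ᵐ[haar K] fun x => f (x + y) :=
  Lp.coeFn_compMeasurePreserving f (measurePreserving_add_right (haar K) y)

theorem transLp_eq {y : LaurentSeries K} {f : Lp ℂ 2 (haar K)} {g : LaurentSeries K → ℂ}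
    (h : f =ᵐ[haar K] g) : transLp y f =ᵐ[haar K] fun x => g (x + y) :=
  (coeFn_transLp y f).trans
    ((measurePreserving_add_right (haar K) y).quasiMeasurePreserving.ae_eq_comp h)

theorem dilLp_transLp (k : ℤ) (y : LaurentSeries K) (f : Lp ℂ 2 (haar K)) :
    dilLp k (transLp (dil k y) f) = transLp y (dilLp k f) := by
  refine Lp.ext ((dilLp_eq (coeFn_transLp _ f)).trans
    ((transLp_eq (coeFn_dilLp k f)).trans ?_).symm)
  simp only [dil_add]
  rfl

/-- A square integrable function invariant under all translations vanishes. -/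
theorem eq_zero_of_transLp_eq {f : Lp ℂ 2 (haar K)} (hf : ∀ y, transLp y f = f) : f = 0 := by
  -- The measure `|f|² dμ` is finite and translation invariant, hence zero.
  let ν := (haar K).withDensity fun x => ‖f x‖ₑ ^ 2
  have hmeas : AEMeasurable (fun x => ‖f x‖ₑ ^ 2) (haar K) :=
    (Lp.aestronglyMeasurable f).enorm.pow_const 2
  have hfin : IsFiniteMeasure ν := by
    refine isFiniteMeasure_withDensity ?_
    have h1 := (Lp.memLp f).2
    rw [eLpNorm_lt_top_iff_lintegral_rpow_enorm_lt_top (by norm_num) (by norm_num)] at h1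
    simp only [ENNReal.toReal_ofNat, ENNReal.rpow_ofNat] at h1
    exact h1.ne
  have hinv : ν.IsAddLeftInvariant := by
    refine ⟨fun y => Measure.ext fun S hS => ?_⟩
    have hS' := hS.preimage (measurable_const_add y)
    rw [Measure.map_apply (measurable_const_add y) hS, withDensity_apply _ hS',
      withDensity_apply _ hS, ← lintegral_indicator hS', ← lintegral_indicator hS,
      ← lintegral_add_left_eq_self (S.indicator _) y]
    refine lintegral_congr_ae ?_
    have h2 := coeFn_transLp y f
    rw [hf y] at h2
    filter_upwards [h2] with x hx
    by_cases hxS : y + x ∈ S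
    · rw [Set.indicator_of_mem (show x ∈ (fun x => y + x) ⁻¹' S from hxS),
        Set.indicator_of_mem hxS, hx, add_comm]
    · rw [Set.indicator_of_notMem (show x ∉ (fun x => y + x) ⁻¹' S from hxS),
        Set.indicator_of_notMem hxS]
  have h0 : ν = 0 := eq_zero_of_isAddLeftInvariant ν
  rw [withDensity_eq_zero_iff hmeas] at h0
  refine Lp.ext ?_
  filter_upwards [h0, Lp.coeFn_zero ℂ 2 (haar K)] with x hx hx0
  rw [hx0]
  simpa using hx

end Operators

/-! ### Density of step functions -/

section Density

variable {K : Type*} [Field K]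

theorem exists_forall_norm_sub_le {g : LaurentSeries K → ℂ} (hg : Continuous g)
    (hgs : HasCompactSupport g) {ε : ℝ} (hε : 0 < ε) :
    ∃ n : ℤ, ∀ x, ∀ y ∈ Ball K n, ‖g (x + y) - g x‖ ≤ ε := by
  have hu := hgs.uniformContinuous_of_continuous hg
  have h1 := hu (Metric.dist_mem_uniformity hε)
  rw [Filter.mem_map, uniformity_eq_comap_nhds_zero, Filter.mem_comap] at h1
  obtain ⟨U, hU, hUs⟩ := h1
  obtain ⟨n, hn⟩ := exists_Ball_subset hU
  refine ⟨n, fun x y hy => ?_⟩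
  have h2 : ((x, x + y) : LaurentSeries K × LaurentSeries K) ∈
      (fun p : LaurentSeries K × LaurentSeries K => p.2 - p.1) ⁻¹' U := by
    rw [Set.mem_preimage]
    simpa using hn hy
  have h3 := hUs h2
  simp only [Set.mem_preimage, Set.mem_ofPred_eq] at h3
  rw [← dist_eq_norm, dist_comm]
  exact h3.le

theorem exists_support_subset_Ball {g : LaurentSeries K → ℂ} (hgs : HasCompactSupport g) :
    ∃ m : ℕ, ∀ x, g x ≠ 0 → x ∈ Ball K (-(m : ℤ)) := by
  obtain ⟨m, hm⟩ := hgs.isCompact.elim_directed_cover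
    (fun m : ℕ => (Ball K (-(m : ℤ)) : Set (LaurentSeries K))) (fun m => isOpen_Ball _)
    (by rw [iUnion_Ball]; exact Set.subset_univ _)
    (directed_of_isDirected_le fun i j hij => Ball_anti (by lia))
  exact ⟨m, fun x hx => hm (subset_tsupport g hx)⟩

theorem finSeries_truncation_congr {n : ℤ} {L : ℕ} {x y : LaurentSeries K}
    (hy : y ∈ Ball K (n + L)) (i : Fin L) :
    (x + y).coeff (n + (i : ℤ)) = x.coeff (n + (i : ℤ)) := by
  have := i.2
  rw [HahnSeries.coeff_add, hy _ (by lia), add_zero]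

theorem mem_Ball_add_iff {n : ℤ} {x y : LaurentSeries K} (hy : y ∈ Ball K n) :
    x + y ∈ Ball K n ↔ x ∈ Ball K n := by
  refine ⟨fun h => ?_, fun h => (Ball K n).add_mem h hy⟩
  have := (Ball K n).sub_mem h hy
  rwa [add_sub_cancel_right] at this

theorem nhds_zero_isCountablyGenerated :
    (𝓝 (0 : LaurentSeries K)).IsCountablyGenerated := by
  have h : (𝓝 (0 : LaurentSeries K)).HasBasis (fun _ : ℤ => True)
      fun n => (Ball K n : Set (LaurentSeries K)) := by
    refine ⟨fun U => ⟨fun hU => ?_, ?_⟩⟩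
    · obtain ⟨n, hn⟩ := exists_Ball_subset hU
      exact ⟨n, trivial, hn⟩
    · rintro ⟨n, -, hn⟩
      exact Filter.mem_of_superset (Ball_mem_nhds n) hn
  exact Filter.HasCountableBasis.isCountablyGenerated ⟨h, Set.to_countable _⟩

instance normalSpace : NormalSpace (LaurentSeries K) := by
  have := nhds_zero_isCountablyGenerated (K := K)
  have : (uniformity (LaurentSeries K)).IsCountablyGenerated :=
    IsUniformAddGroup.uniformity_countably_generated
  have : TopologicalSpace.PseudoMetrizableSpace (LaurentSeries K) := inferInstance
  infer_instance

/-- The step function samples `g` at the truncation `t x` of `x`. Uniform continuity bounds the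
error on a ball containing the support; outside it both functions vanish. -/
theorem exists_stepFun_eLpNorm_sub_le [Fintype K] {g : LaurentSeries K → ℂ} (hg : Continuous g)
    (hgs : HasCompactSupport g) {ε : ENNReal} (hε : ε ≠ 0) :
    ∃ (M n : ℤ) (f : LaurentSeries K → ℂ), f ∈ stepFun M n ∧ eLpNorm (g - f) 2 (haar K) ≤ ε := by
  obtain ⟨m, hm⟩ := exists_support_subset_Ball hgs
  set C := (haar K) (Ball K (-(m : ℤ))) ^ (1 / (2 : ENNReal).toReal) with hC
  have hCt : C ≠ ⊤ := by
    rw [hC, haar_Ball]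
    exact (ENNReal.rpow_lt_top_of_nonneg (by positivity) (zpow_card_ne_top _)).ne
  obtain ⟨δ, hδ, hδε⟩ := ENNReal.exists_nnreal_pos_mul_lt hCt hε
  obtain ⟨n, hn⟩ := exists_forall_norm_sub_le hg hgs (show (0 : ℝ) < δ from hδ)
  -- Then `-m + L ≥ n`, so `x - t x` lies in the ball `F_n` of uniform continuity.
  set L := (n + m).toNat with hL
  let t : LaurentSeries K → LaurentSeries K := fun x =>
    finSeries (-(m : ℤ)) fun i : Fin L => x.coeff (-(m : ℤ) + (i : ℤ))
  let f : LaurentSeries K → ℂ :=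
    (Ball K (-(m : ℤ)) : Set (LaurentSeries K)).indicator fun x => g (t x)
  refine ⟨-(m : ℤ) + L, -(m : ℤ), f, ⟨fun x y hy => ?_, fun x hx => Set.mem_of_indicator_ne_zero hx⟩,
    ?_⟩
  · have hy' : y ∈ Ball K (-(m : ℤ)) := Ball_anti (by lia) hy
    have ht : t (x + y) = t x := by
      simp only [t, finSeries_truncation_congr hy]
    have hiff : x + y ∈ (Ball K (-(m : ℤ)) : Set (LaurentSeries K)) ↔
        x ∈ (Ball K (-(m : ℤ)) : Set (LaurentSeries K)) := mem_Ball_add_iff hy'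
    simp only [f]
    by_cases hx : x ∈ (Ball K (-(m : ℤ)) : Set (LaurentSeries K))
    · rw [Set.indicator_of_mem hx, Set.indicator_of_mem (hiff.2 hx), ht]
    · rw [Set.indicator_of_notMem hx, Set.indicator_of_notMem fun h => hx (hiff.1 h)]
  · have hle : ∀ x, ‖(g - f) x‖ ≤
        ‖(Ball K (-(m : ℤ)) : Set (LaurentSeries K)).indicator (fun _ => (δ : ℝ)) x‖ := by
      intro x
      by_cases hx : x ∈ (Ball K (-(m : ℤ)) : Set (LaurentSeries K))
      · have h1 := hn (t x) (x - t x) (Ball_anti (by lia) (sub_finSeries_mem L hx))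
        rw [add_sub_cancel] at h1
        simpa [f, Set.indicator_of_mem hx] using h1
      · have h1 : g x = 0 := by
          by_contra h
          exact hx (hm x h)
        simp [f, Set.indicator_of_notMem hx, h1]
    refine (eLpNorm_mono hle).trans ?_
    rw [eLpNorm_indicator_const (measurableSet_Ball _) (by norm_num) (by norm_num)]
    refine le_of_eq_of_le ?_ hδε.le
    simp [hC, enorm_eq_nnnorm]

theorem exists_stepFun_dist_lt [Fintype K] (F : Lp ℂ 2 (haar K)) {ε : ℝ} (hε : 0 < ε) :
    ∃ (M n : ℤ) (f : LaurentSeries K → ℂ) (hf : f ∈ stepFun M n),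
      dist F ((memLp_of_stepFun hf 2).toLp f) < ε := by
  have hε4 : ENNReal.ofReal (ε / 4) ≠ 0 := by simpa using hε
  obtain ⟨g, hgs, hgF, hg, hgL⟩ :=
    (Lp.memLp F).exists_hasCompactSupport_eLpNorm_sub_le (by norm_num) hε4
  obtain ⟨M, n, f, hf, hfg⟩ := exists_stepFun_eLpNorm_sub_le hg hgs hε4
  refine ⟨M, n, f, hf, ?_⟩
  have h1 : dist F (hgL.toLp g) ≤ ε / 4 := by
    rw [← Lp.toLp_coeFn F (Lp.memLp F), dist_eq_norm, ← MemLp.toLp_sub, Lp.norm_toLp]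
    exact ENNReal.toReal_le_of_le_ofReal (by positivity) hgF
  have h2 : dist (hgL.toLp g) ((memLp_of_stepFun hf 2).toLp f) ≤ ε / 4 := by
    rw [dist_eq_norm, ← MemLp.toLp_sub, Lp.norm_toLp]
    exact ENNReal.toReal_le_of_le_ofReal (by positivity) hfg
  calc _ ≤ ε / 4 + ε / 4 := (dist_triangle _ _ _).trans (add_le_add h1 h2)
    _ < ε := by linarith

end Density

/-! ### Multiresolution analyses generated by step functions -/

section MRA

variable {K : Type*} [Field K]

variable (K) in
/-- The shifts form an additive group. -/
def shiftsAddSubgroup : AddSubgroup (LaurentSeries K) where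
  carrier := shifts K
  zero_mem' := fun _ _ => rfl
  add_mem' := by
    intro x y hx hy j hj
    rw [HahnSeries.coeff_add, hx j hj, hy j hj, add_zero]
  neg_mem' := by
    intro x hx j hj
    rw [HahnSeries.coeff_neg, hx j hj, neg_zero]

theorem dil_mem_shifts {k : ℕ} {h : LaurentSeries K} (hh : h ∈ shifts K) :
    dil (k : ℤ) h ∈ shifts K := by
  intro j hj
  rw [coeff_dil]
  exact hh _ (by lia)

theorem exists_shift_sub_mem_Ball (x : LaurentSeries K) : ∃ h ∈ shifts K, x - h ∈ Ball K 0 := by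
  obtain ⟨m, hm⟩ := exists_mem_Ball x
  refine ⟨_, finSeries_mem_shifts fun i : Fin m => x.coeff (-(m : ℤ) + (i : ℤ)), ?_⟩
  have := sub_finSeries_mem m hm
  rwa [neg_add_cancel] at this

variable [Fintype K] {φ : LaurentSeries K → ℂ} {M n₀ : ℤ}

/-- The translate `φ (· - h)` as an element of `L²`. -/
def shiftLp (hφ : φ ∈ stepFun M n₀) (h : LaurentSeries K) : Lp ℂ 2 (haar K) :=
  (memLp_comp_sub hφ h 2).toLp

theorem coeFn_shiftLp (hφ : φ ∈ stepFun M n₀) (h : LaurentSeries K) :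
    shiftLp hφ h =ᵐ[haar K] fun x => φ (x - h) :=
  MemLp.coeFn_toLp _

/-- The closed linear span of the shifts of `φ`. -/
def shiftSpan (hφ : φ ∈ stepFun M n₀) : Submodule ℂ (Lp ℂ 2 (haar K)) :=
  (Submodule.span ℂ (Set.range fun h : shifts K => shiftLp hφ h)).topologicalClosure

/-- The dilates of the closed linear span of the shifts of `φ`. -/
def scaleSpace (hφ : φ ∈ stepFun M n₀) (n : ℤ) : Submodule ℂ (Lp ℂ 2 (haar K)) :=
  (shiftSpan hφ).comap (dilLp (-n)).toLinearMap

theorem mem_scaleSpace {hφ : φ ∈ stepFun M n₀} {n : ℤ} {f : Lp ℂ 2 (haar K)} :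
    f ∈ scaleSpace hφ n ↔ dilLp (-n) f ∈ shiftSpan hφ := Iff.rfl

theorem shiftLp_mem_shiftSpan (hφ : φ ∈ stepFun M n₀) {h : LaurentSeries K} (hh : h ∈ shifts K) :
    shiftLp hφ h ∈ shiftSpan hφ :=
  Submodule.le_topologicalClosure _ (Submodule.subset_span ⟨⟨h, hh⟩, rfl⟩)

theorem shiftSpan_le (hφ : φ ∈ stepFun M n₀) {W : Submodule ℂ (Lp ℂ 2 (haar K))}
    (hW : IsClosed (W : Set (Lp ℂ 2 (haar K)))) (h : ∀ h ∈ shifts K, shiftLp hφ h ∈ W) :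
    shiftSpan hφ ≤ W := by
  refine Submodule.topologicalClosure_minimal _ (Submodule.span_le.2 ?_) hW
  rintro _ ⟨g, rfl⟩
  exact h g g.2

theorem isClosed_shiftSpan (hφ : φ ∈ stepFun M n₀) :
    IsClosed (shiftSpan hφ : Set (Lp ℂ 2 (haar K))) :=
  Submodule.isClosed_topologicalClosure _

theorem isClosed_scaleSpace (hφ : φ ∈ stepFun M n₀) (n : ℤ) :
    IsClosed (scaleSpace hφ n : Set (Lp ℂ 2 (haar K))) :=
  (isClosed_shiftSpan hφ).preimage (dilLp (-n)).continuous

theorem scaleSpace_zero (hφ : φ ∈ stepFun M n₀) : scaleSpace hφ 0 = shiftSpan hφ := by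
  ext f
  rw [mem_scaleSpace, neg_zero, dilLp_zero]

theorem coeFn_sum_smul {α ι : Type*} [MeasurableSpace α] {μ : Measure α} (S : Finset ι)
    (a : ι → ℂ) (F : ι → Lp ℂ 2 μ) {f : ι → α → ℂ} (hF : ∀ i, F i =ᵐ[μ] f i) :
    (∑ i ∈ S, a i • F i : Lp ℂ 2 μ) =ᵐ[μ] fun x => ∑ i ∈ S, a i * f i x := by
  classical
  induction S using Finset.induction_on with
  | empty =>
    simp only [Finset.sum_empty]
    exact Lp.coeFn_zero ℂ 2 μ
  | insert i S hi ih =>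
    rw [Finset.sum_insert hi]
    filter_upwards [Lp.coeFn_add (a i • F i) (∑ i ∈ S, a i • F i), Lp.coeFn_smul (a i) (F i), hF i,
      ih] with x h1 h2 h3 h4
    rw [h1, Pi.add_apply, h2, Pi.smul_apply, h3, h4, Finset.sum_insert hi, smul_eq_mul]

/-- It suffices to treat `V_0`: substituting `A^{-1}x - h` in the refinement equation yields
translates by `Ah + w i`, which are again shifts. -/
theorem scaleSpace_le_succ (hφ : φ ∈ stepFun M n₀) {ι : Type*} [Fintype ι] {β : ι → ℂ}
    {w : ι → LaurentSeries K} (hw : ∀ i, w i ∈ shifts K)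
    (href : ∀ x, φ x = ∑ i, β i * φ (dil 1 x - w i)) (n : ℤ) :
    scaleSpace hφ n ≤ scaleSpace hφ (n + 1) := by
  have key : shiftSpan hφ ≤ (shiftSpan hφ).comap (dilLp (-1)).toLinearMap := by
    refine shiftSpan_le hφ ((isClosed_shiftSpan hφ).preimage (dilLp (-1)).continuous) fun h hh => ?_
    have h1 : dilLp (-1) (shiftLp hφ h) = ∑ i, β i • shiftLp hφ (dil 1 h + w i) := by
      refine Lp.ext ((dilLp_eq (coeFn_shiftLp hφ h)).trans ?_)
      refine Filter.EventuallyEq.trans (Filter.Eventually.of_forall fun x => ?_)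
        (coeFn_sum_smul Finset.univ β _ fun i => coeFn_shiftLp hφ (dil 1 h + w i)).symm
      simp only
      rw [href]
      refine Finset.sum_congr rfl fun i _ => ?_
      rw [dil_sub, dil_dil, add_neg_cancel, dil_zero, sub_sub]
    show dilLp (-1) (shiftLp hφ h) ∈ shiftSpan hφ
    rw [h1]
    exact Submodule.sum_mem _ fun i _ => Submodule.smul_mem _ _ (shiftLp_mem_shiftSpan hφ
      ((shiftsAddSubgroup K).add_mem (dil_mem_shifts (k := 1) hh) (hw i)))
  intro f hf
  have h1 := key hf
  rw [Submodule.mem_comap] at h1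
  have h2 : dilLp (-1) (dilLp (-n) f) = dilLp (-(n + 1)) f := by
    rw [dilLp_dilLp]
    congr 2
    ring
  rw [mem_scaleSpace, ← h2]
  exact h1

theorem mem_scaleSpace_succ_iff (hφ : φ ∈ stepFun M n₀) (n : ℤ) {f g : Lp ℂ 2 (haar K)}
    (hfg : ∀ᵐ x ∂(haar K), g x = f (dil 1 x)) :
    f ∈ scaleSpace hφ n ↔ g ∈ scaleSpace hφ (n + 1) := by
  have hg : g = dilLp 1 f := Lp.ext (Filter.EventuallyEq.trans hfg (coeFn_dilLp 1 f).symm)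
  rw [mem_scaleSpace, mem_scaleSpace, hg, dilLp_dilLp]
  congr! 3
  ring

/-- The fixed vectors of a translation form a closed subspace, and it contains every shift of `φ`.
-/
theorem transLp_of_mem_shiftSpan (hφ : φ ∈ stepFun M n₀) {y : LaurentSeries K}
    (hy : y ∈ Ball K M) {f : Lp ℂ 2 (haar K)} (hf : f ∈ shiftSpan hφ) : transLp y f = f := by
  let W : Submodule ℂ (Lp ℂ 2 (haar K)) :=
    LinearMap.eqLocus (transLp y).toLinearMap LinearMap.id
  have hW : IsClosed (W : Set (Lp ℂ 2 (haar K))) :=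
    isClosed_eq (transLp y).continuous continuous_id
  have h1 : shiftSpan hφ ≤ W := by
    refine shiftSpan_le hφ hW fun h _ => ?_
    show transLp y (shiftLp hφ h) = shiftLp hφ h
    refine Lp.ext ((transLp_eq (coeFn_shiftLp hφ h)).trans ?_)
    refine Filter.EventuallyEq.trans (Filter.Eventually.of_forall fun x => ?_)
      (coeFn_shiftLp hφ h).symm
    simp only
    rw [add_sub_right_comm, hφ.1 _ y hy]
  exact h1 hf

/-- Elements of `V_n` are invariant under `F_{M+n}`, and these balls exhaust `F` as `n → -∞`. -/
theorem iInf_scaleSpace (hφ : φ ∈ stepFun M n₀) : ⨅ n, scaleSpace hφ n = ⊥ := by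
  rw [eq_bot_iff]
  intro f hf
  rw [Submodule.mem_iInf] at hf
  refine (Submodule.mem_bot ℂ).2 (eq_zero_of_transLp_eq fun z => ?_)
  obtain ⟨m, hm⟩ := exists_mem_Ball z
  set n : ℤ := -(m : ℤ) - M with hn
  have hy : dil n z ∈ Ball K M := dil_mem_Ball.2 (by rwa [hn, add_sub_cancel])
  have h1 := transLp_of_mem_shiftSpan hφ hy (mem_scaleSpace.1 (hf n))
  rw [← dilLp_transLp, dil_dil, neg_add_cancel, dil_zero] at h1
  have h2 := congrArg (dilLp n) h1
  rwa [dilLp_dilLp, dilLp_dilLp, add_neg_cancel, dilLp_zero, dilLp_zero] at h2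

/-- If finitely many shifts of `φ` add up to the indicator function of a ball, then `V n` contains
the indicator functions of all translates of a ball. -/
theorem indicator_mem_scaleSpace (hφ : φ ∈ stepFun M n₀) (hn₀ : n₀ ≤ 0) {ι : Type*} [Fintype ι]
    {w : ι → LaurentSeries K} (hw : ∀ i, w i ∈ shifts K)
    (hsum : ∀ x, ∑ i, φ (x + w i) =
      (Ball K n₀ : Set (LaurentSeries K)).indicator (fun _ => (1 : ℂ)) x)
    (n : ℤ) (a : LaurentSeries K) {F : Lp ℂ 2 (haar K)}
    (hF : F =ᵐ[haar K] fun x =>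
      (Ball K (n₀ + n) : Set (LaurentSeries K)).indicator (fun _ => (1 : ℂ)) (x + a)) :
    F ∈ scaleSpace hφ n := by
  -- Dilation turns the translate by `a` into one by `A^n a`, which may be replaced by a shift `h`:
  -- the difference lies in `F_0 ⊂ F_{n₀}`.
  obtain ⟨h, hh, hah⟩ := exists_shift_sub_mem_Ball (dil n a)
  rw [mem_scaleSpace]
  have h1 : dilLp (-n) F = ∑ i, (1 : ℂ) • shiftLp hφ (-(h + w i)) := by
    refine Lp.ext ((dilLp_eq hF).trans ?_)
    refine Filter.EventuallyEq.trans (Filter.Eventually.of_forall fun x => ?_)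
      (coeFn_sum_smul Finset.univ (fun _ => 1) _ fun i => coeFn_shiftLp hφ (-(h + w i))).symm
    simp only [one_mul, sub_neg_eq_add, ← add_assoc]
    rw [hsum]
    have hiff : dil (-n) x + a ∈ (Ball K (n₀ + n) : Set (LaurentSeries K)) ↔
        x + h ∈ (Ball K n₀ : Set (LaurentSeries K)) := by
      have h2 : dil (-n) x + a = dil (-n) (x + h + (dil n a - h)) := by
        rw [add_add_sub_cancel, dil_add, dil_dil, neg_add_cancel, dil_zero]
      rw [h2, SetLike.mem_coe, SetLike.mem_coe, dil_mem_Ball, add_neg_cancel_right,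
        mem_Ball_add_iff (Ball_anti hn₀ hah)]
    by_cases hx : x + h ∈ (Ball K n₀ : Set (LaurentSeries K))
    · rw [Set.indicator_of_mem hx, Set.indicator_of_mem (hiff.2 hx)]
    · rw [Set.indicator_of_notMem hx, Set.indicator_of_notMem fun h => hx (hiff.1 h)]
  rw [h1]
  exact Submodule.sum_mem _ fun i _ => Submodule.smul_mem _ _ (shiftLp_mem_shiftSpan hφ
    ((shiftsAddSubgroup K).neg_mem ((shiftsAddSubgroup K).add_mem hh (hw i))))

theorem memLp_indicator_Ball (n : ℤ) (a : LaurentSeries K) :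
    MemLp (fun x => (Ball K n : Set (LaurentSeries K)).indicator (fun _ => (1 : ℂ)) (x + a)) 2
      (haar K) := by
  have h : (Ball K n : Set (LaurentSeries K)).indicator (fun _ => (1 : ℂ)) ∈ stepFun n n := by
    refine ⟨fun x y hy => ?_, fun x hx => Set.mem_of_indicator_ne_zero hx⟩
    have hiff : x + y ∈ (Ball K n : Set (LaurentSeries K)) ↔
        x ∈ (Ball K n : Set (LaurentSeries K)) := mem_Ball_add_iff hy
    by_cases hx : x ∈ (Ball K n : Set (LaurentSeries K))
    · rw [Set.indicator_of_mem hx, Set.indicator_of_mem (hiff.2 hx)]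
    · rw [Set.indicator_of_notMem hx, Set.indicator_of_notMem fun h => hx (hiff.1 h)]
  simpa only [sub_neg_eq_add] using memLp_comp_sub h (-a) 2

/-- The finite series represent the cosets of `F_{m+L}` in `F_m`; for `x ∈ F_m` only the term of its
own truncation survives. -/
theorem stepFun_eq_sum {m : ℤ} {L : ℕ} {f : LaurentSeries K → ℂ} (hf : f ∈ stepFun (m + L) m)
    (x : LaurentSeries K) : f x = ∑ c : Fin L → K, f (finSeries m c) *
      (Ball K (m + L) : Set (LaurentSeries K)).indicator (fun _ => (1 : ℂ))
        (x + -finSeries m c) := by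
  by_cases hx : x ∈ Ball K m
  · rw [Finset.sum_eq_single fun i : Fin L => x.coeff (m + (i : ℤ))]
    · have h1 := sub_finSeries_mem L hx
      have h2 := hf.1 (finSeries m fun i : Fin L => x.coeff (m + (i : ℤ))) _ h1
      rw [add_sub_cancel] at h2
      rw [← sub_eq_add_neg, Set.indicator_of_mem (show x - finSeries m _ ∈
        (Ball K (m + L) : Set (LaurentSeries K)) from h1), mul_one, h2]
    · intro c _ hc
      rw [Set.indicator_of_notMem, mul_zero]
      intro hmem
      refine hc (funext fun i => ?_)
      have h3 := hmem (m + i) (by have := i.2; lia)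
      rw [HahnSeries.coeff_add, HahnSeries.coeff_neg, coeff_finSeries, add_neg_eq_zero] at h3
      exact h3.symm
    · simp
  · have h0 : f x = 0 := by
      by_contra h
      exact hx (hf.2 x h)
    rw [h0, eq_comm]
    refine Finset.sum_eq_zero fun c _ => ?_
    rw [Set.indicator_of_notMem, mul_zero]
    intro hmem
    have h1 := (Ball K m).add_mem (Ball_anti (by lia) hmem) (finSeries_mem_Ball m c)
    rw [neg_add_cancel_right] at h1
    exact hx h1

theorem dense_iUnion_scaleSpace (hφ : φ ∈ stepFun M n₀) (hn₀ : n₀ ≤ 0) {ι : Type*} [Fintype ι]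
    {w : ι → LaurentSeries K} (hw : ∀ i, w i ∈ shifts K)
    (hsum : ∀ x, ∑ i, φ (x + w i) =
      (Ball K n₀ : Set (LaurentSeries K)).indicator (fun _ => (1 : ℂ)) x) :
    Dense (⋃ n, (scaleSpace hφ n : Set (Lp ℂ 2 (haar K)))) := by
  refine Metric.dense_iff.2 fun F ε hε => ?_
  obtain ⟨M', m, f, hf, hdist⟩ := exists_stepFun_dist_lt F hε
  refine ⟨_, Metric.mem_ball'.2 hdist, ?_⟩
  obtain ⟨L, hL⟩ : ∃ L : ℕ, M' ≤ m + L := ⟨(M' - m).toNat, by lia⟩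
  have hf' : f ∈ stepFun (m + L) m := stepFun_mono hL le_rfl hf
  -- This scale makes `n₀ + n = m + L`, so the indicators available in `V_n` are those of the cosets
  -- on which `f` is constant.
  refine Set.mem_iUnion.2 ⟨m + L - n₀, ?_⟩
  have h1 : (memLp_of_stepFun hf 2).toLp f =
      ∑ c : Fin L → K, f (finSeries m c) •
        (memLp_indicator_Ball (m + L) (-finSeries m c)).toLp := by
    refine Lp.ext ((MemLp.coeFn_toLp _).trans ?_)
    refine Filter.EventuallyEq.trans (Filter.Eventually.of_forall fun x => ?_)
      (coeFn_sum_smul Finset.univ (fun c : Fin L → K => f (finSeries m c)) _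
        fun c => MemLp.coeFn_toLp (memLp_indicator_Ball (m + L) (-finSeries m c))).symm
    exact stepFun_eq_sum hf' x
  rw [h1, SetLike.mem_coe]
  refine Submodule.sum_mem _ fun c _ => Submodule.smul_mem _ _ ?_
  refine indicator_mem_scaleSpace hφ hn₀ hw hsum _ (-finSeries m c) ?_
  rw [add_sub_cancel]
  exact MemLp.coeFn_toLp _

theorem orthonormal_shiftLp (hφ : φ ∈ stepFun M n₀)
    (horth : ∀ δ ∈ shifts K, δ ≠ 0 → ∫ x, conj (φ x) * φ (x - δ) ∂(haar K) = 0)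
    (hnorm : ∫ x, conj (φ x) * φ x ∂(haar K) = 1) :
    Orthonormal ℂ fun h : shifts K => shiftLp hφ h := by
  classical
  rw [orthonormal_iff_ite]
  intro h g
  -- Translation invariance reduces the pair `(h, g)` to the difference `g - h`, again a shift.
  have h1 : inner ℂ (shiftLp hφ h) (shiftLp hφ g) =
      ∫ x, conj (φ x) * φ (x - ((g : LaurentSeries K) - h)) ∂(haar K) := by
    rw [L2.inner_def, ← integral_sub_right_eq_self (fun x => conj (φ x) * _) (h : LaurentSeries K)]
    refine integral_congr_ae ?_
    filter_upwards [coeFn_shiftLp hφ h, coeFn_shiftLp hφ g] with x hx hy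
    rw [hx, hy, RCLike.inner_apply, mul_comm, sub_sub_sub_cancel_right]
  rw [h1]
  split_ifs with heq
  · rw [heq, sub_self]
    simpa only [sub_zero] using hnorm
  · exact horth _ ((shiftsAddSubgroup K).sub_mem g.2 h.2)
      (sub_ne_zero.2 fun h => heq (Subtype.ext h.symm))

/-- A step function which satisfies a refinement equation, has orthonormal shifts, and has finitely
many shifts adding up to the indicator function of a ball, is an orthogonal scaling function. -/
theorem isOrthogonalScalingFunction_of_stepFun (hφ : φ ∈ stepFun M n₀) (hn₀ : n₀ ≤ 0)
    (horth : ∀ δ ∈ shifts K, δ ≠ 0 → ∫ x, conj (φ x) * φ (x - δ) ∂(haar K) = 0)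
    (hnorm : ∫ x, conj (φ x) * φ x ∂(haar K) = 1)
    {ι : Type*} [Fintype ι] {β : ι → ℂ} {w : ι → LaurentSeries K} (hw : ∀ i, w i ∈ shifts K)
    (href : ∀ x, φ x = ∑ i, β i * φ (dil 1 x - w i))
    {κ : Type*} [Fintype κ] {v : κ → LaurentSeries K} (hv : ∀ i, v i ∈ shifts K)
    (hsum : ∀ x, ∑ i, φ (x + v i) =
      (Ball K n₀ : Set (LaurentSeries K)).indicator (fun _ => (1 : ℂ)) x) :
    IsOrthogonalScalingFunction φ :=
  ⟨scaleSpace hφ,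
    { isClosed := isClosed_scaleSpace hφ
      mono := scaleSpace_le_succ hφ hw href
      dense := dense_iUnion_scaleSpace hφ hn₀ hv hsum
      inter := iInf_scaleSpace hφ
      dilation := fun n _ _ hfg => mem_scaleSpace_succ_iff hφ n hfg
      basis := ⟨fun h => shiftLp hφ h, fun h => coeFn_shiftLp hφ h,
        orthonormal_shiftLp hφ horth hnorm, (scaleSpace_zero hφ).symm⟩ }⟩

end MRA

end LocalFieldMRA

end

open LocalFieldMRA in
theorem theorem4p3 {p s : ℕ} [Fact p.Prime] {K : Type*} [Field K] [Fintype K]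
    [Algebra (ZMod p) K] (b : Module.Basis (Fin s) (ZMod p) K)
    {N : ℕ} (hN : 1 ≤ N) {V : Type*} (T : RTree V) (lab : V → K) (hT : T.NValid lab N)
    (m₀ : Characters K → ℂ) (hmask : IsMask N m₀)
    (hm₀ : IsAdapted b (arrayDigraph hT.derivedTree) m₀) :
    (∀ χ, Multipliable fun k : ℕ => m₀ (dilChar χ (-(k : ℤ)))) ∧
    ∃ M : ℕ, N + M ≤ hT.derivedTree.height ∧
      maskProduct m₀ ∈ dualStepFun (K := K) (-(N : ℤ)) M ∧
      ∃ φ ∈ stepFun (K := K) M (-(N : ℤ)),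
        (∀ χ, fourier φ χ = maskProduct m₀ χ) ∧ IsOrthogonalScalingFunction φ := by
  classical
  have hle := hT.le_height
  -- The largest admissible `M` is taken; the subtraction in `ℕ` does not truncate because `N ≤ H̃`.
  have hM : ((hT.derivedTree.height - N : ℕ) : ℤ) = (hT.derivedTree.height : ℤ) - N := by lia
  refine ⟨hm₀.multipliable, hT.derivedTree.height - N, by lia, ?_,
    scalingFun b N hT.derivedTree.height m₀, ?_, hm₀.fourier_scalingFun hN hmask, ?_⟩
  · rw [hM]
    exact hm₀.maskProduct_mem_dualStepFun hN hmask
  · rw [hM]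
    exact hm₀.scalingFun_mem_stepFun hN hmask
  · obtain ⟨β, hβ⟩ := hm₀.exists_refinement hN hmask
    refine isOrthogonalScalingFunction_of_stepFun (hm₀.scalingFun_mem_stepFun hN hmask) (by lia)
      (fun δ hδ hδ0 => ?_) ?_ shiftElt_mem_shifts hβ finSeries_mem_shifts
      (hm₀.sum_scalingFun_add hmask hT.derivedTree.height)
    · rw [hm₀.integral_conj_scalingFun hN hmask hδ, if_neg hδ0]
    · have h := hm₀.integral_conj_scalingFun hN hmask (shiftsAddSubgroup K).zero_mem
      rw [if_pos rfl] at h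
      simpa only [sub_zero] using h
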